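/- Let $M$ be a compact connected smooth Riemannian manifold without boundary, and let $H:T^*M\to\mathbb R$ be continuous, convex in $p\in T_x^*M$ for every $x\in M$, and superlinear in $p$, i.e. $H(x,p)/|p|\to+\infty$ as $|p|\to+\infty$, for every $x\in M$. Let $$L(x,v)=\max_{p\in T_x^*M}\{\langle p,v\rangle-H(x,p)\},\qquad \widehat L(x,v)=L(x,-v),\qquad (x,v)\in TM .$$ For $u:M\to\mathbb R$ and $c\in\mathbb R$ write $u\prec L+c$ if $$u(\gamma(b))-u(\gamma(a))\le\int_a^b\big(L(\gamma,\dot\gamma)+c\big)\,dt$$ for every absolutely continuous curve $\gamma:[a,b]\to M$, $a\le b$ (the integral may be $+\infty$), and let $$c(H)=\inf\{c\in\mathbb R:\ \text{there is } w\in C(M,\mathbb R)\text{ with } w\prec L+c\}.$$ For $\lambda>0$ and $x\in M$ let $$u_\lambda^+(x)=-\inf_{\gamma(0)=x}\int_0^{+\infty}e^{-\lambda t}\big(L(\gamma,\dot\gamma)+c(H)\big)\,dt,\qquad \widehat u_\lambda^-(x)=\inf_{\gamma(0)=x}\int_{-\infty}^0e^{\lambda t}\big(\widehat L(\gamma,\dot\gamma)+c(H)\big)\,dt,$$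 the infima being over the (locally) absolutely continuous curves $\gamma:[0,+\infty)\to M$, respectively $\gamma:(-\infty,0]\to M$, with $\gamma(0)=x$. Then, as $\lambda\to0_+$, the functions $\widehat u_\lambda^-$ and $u_\lambda^+$ converge uniformly on $M$ to functions $\widehat u_0^-$ and $u_0^+$ with $u_0^+=-\widehat u_0^-$, and $u_0^+$ is a forward $0$-weak KAM solution of $H(x,d_xu)=c(H)$. That is, $u_0^+\prec L+c(H)$, and for every $x\in M$ there is a (locally) absolutely continuous curve $\gamma_x^+:[0,+\infty)\to M$ with $\gamma_x^+(0)=x$ such that, for all $0\le s<t$, $$u_0^+(\gamma_x^+(t))-u_0^+(\gamma_x^+(s))=\int_s^t\big(L(\gamma_x^+,\dot\gamma_x^+)+c(H)\big)\,d\tau ,$$ the integral being finite. -/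

import Mathlib

open Set Filter Topology MeasureTheory
open scoped Manifold ContDiff Bundle

noncomputable section

namespace WeakKAM

variable {n : ℕ} {M : Type*}

section Fibers

variable [TopologicalSpace M] [ChartedSpace (EuclideanSpace ℝ (Fin n)) M]

/-- The cotangent space `T*_x M`. -/
abbrev CotangentSpace (n : ℕ) {M : Type*} [TopologicalSpace M]
    [ChartedSpace (EuclideanSpace ℝ (Fin n)) M] (x : M) : Type :=
  TangentSpace (𝓡 n) x →L[ℝ] Bundle.Trivial M ℝ x

/-- The cotangent bundle `T*M`; its topology is the one of the bundle of continuous linear maps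
from the tangent bundle to the trivial line bundle. -/
abbrev CotangentBundle (n : ℕ) (M : Type*) [TopologicalSpace M]
    [ChartedSpace (EuclideanSpace ℝ (Fin n)) M] : Type _ :=
  Bundle.TotalSpace (EuclideanSpace ℝ (Fin n) →L[ℝ] ℝ) (fun x : M => CotangentSpace n x)

/-- The Lagrangian `L(x,v) = max_p (⟨p,v⟩ - H(x,p))` of a Hamiltonian `H`. -/
def lagrangian (H : (x : M) → CotangentSpace n x → ℝ) (x : M) (v : TangentSpace (𝓡 n) x) : ℝ :=
  ⨆ p : CotangentSpace n x, (p v - H x p)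

/-- The symmetrical Lagrangian `(x,v) ↦ L(x,-v)`. -/
def symmetric (L : (x : M) → TangentSpace (𝓡 n) x → ℝ) (x : M) (v : TangentSpace (𝓡 n) x) : ℝ :=
  L x (-v)

/-- The velocity `γ'(t) ∈ T_{γ(t)} M`; an absolutely continuous curve has one at almost every
time of the interior of its interval. -/
def velocity (n : ℕ) {M : Type*} [TopologicalSpace M]
    [ChartedSpace (EuclideanSpace ℝ (Fin n)) M] (γ : ℝ → M) (t : ℝ) :
    TangentSpace (𝓡 n) (γ t) :=
  mfderiv 𝓘(ℝ, ℝ) (𝓡 n) γ t (1 : ℝ)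

end Fibers

section Curves

variable [MetricSpace M] [ChartedSpace (EuclideanSpace ℝ (Fin n)) M]

/-- `u ≺ L + c`: for every absolutely continuous `γ : [a,b] → M`,
`u(γ(b)) - u(γ(a)) ≤ ∫_a^b (L(γ,γ') + c) dt`. A Lagrangian that is bounded below has integral `+∞`
along a curve where it is not integrable, and then the inequality says nothing. -/
def Dominated (L : (x : M) → TangentSpace (𝓡 n) x → ℝ) (c : ℝ) (u : M → ℝ) : Prop :=
  ∀ (a b : ℝ) (γ : ℝ → M), a ≤ b → AbsolutelyContinuousOnInterval γ a b →
    IntervalIntegrable (fun t => L (γ t) (velocity n γ t) + c) volume a b →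
    u (γ b) - u (γ a) ≤ ∫ t in a..b, (L (γ t) (velocity n γ t) + c)

/-- The critical value: the infimum of the `c` for which `H(x, d_x w) = c` has a continuous
subsolution `w ≺ L + c`. -/
def criticalValue (H : (x : M) → CotangentSpace n x → ℝ) : ℝ :=
  sInf {c : ℝ | ∃ w : M → ℝ, Continuous w ∧ Dominated (lagrangian H) c w}

/-- The function `u_λ⁺(x) = - inf ∫_0^∞ e^{-λt} (L(γ,γ') + c(H)) dt` over the absolutely continuous
curves `γ : [0,∞) → M` with `γ(0) = x`. Curves of infinite cost are left out of the infimum; the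
constant curve has finite cost. -/
def forwardValue (H : (x : M) → CotangentSpace n x → ℝ) (lam : ℝ) (x : M) : ℝ :=
  -sInf {r : ℝ | ∃ γ : ℝ → M, γ 0 = x ∧
    (∀ T : ℝ, 0 ≤ T → AbsolutelyContinuousOnInterval γ 0 T) ∧
    IntegrableOn (fun t => Real.exp (-lam * t) *
      (lagrangian H (γ t) (velocity n γ t) + criticalValue H)) (Ioi 0) ∧
    r = ∫ t in Ioi (0 : ℝ), Real.exp (-lam * t) *
      (lagrangian H (γ t) (velocity n γ t) + criticalValue H)}

/-- The function `û_λ⁻(x) = inf ∫_{-∞}^0 e^{λt} (L(γ,-γ') + c(H)) dt` over the absolutely continuous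
curves `γ : (-∞,0] → M` with `γ(0) = x`. -/
def symmetricBackwardValue (H : (x : M) → CotangentSpace n x → ℝ) (lam : ℝ) (x : M) : ℝ :=
  sInf {r : ℝ | ∃ γ : ℝ → M, γ 0 = x ∧
    (∀ T : ℝ, 0 ≤ T → AbsolutelyContinuousOnInterval γ (-T) 0) ∧
    IntegrableOn (fun t => Real.exp (lam * t) *
      (symmetric (lagrangian H) (γ t) (velocity n γ t) + criticalValue H)) (Iio 0) ∧
    r = ∫ t in Iio (0 : ℝ), Real.exp (lam * t) *
      (symmetric (lagrangian H) (γ t) (velocity n γ t) + criticalValue H)}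

/-- Along `γ : [0,∞) → M`, `u(γ(t)) - u(γ(s)) = ∫_s^t (L(γ,γ') + c) dτ` for all `0 ≤ s < t`. -/
def ForwardCalibrated (L : (x : M) → TangentSpace (𝓡 n) x → ℝ) (c : ℝ) (u : M → ℝ)
    (γ : ℝ → M) : Prop :=
  ∀ s t : ℝ, 0 ≤ s → s < t →
    IntervalIntegrable (fun τ => L (γ τ) (velocity n γ τ) + c) volume s t ∧
    u (γ t) - u (γ s) = ∫ τ in s..t, (L (γ τ) (velocity n γ τ) + c)

/-- `u` is a forward 0-weak KAM solution of `H(x, d_x u) = c(H)`. -/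
def IsForwardWeakKAM (H : (x : M) → CotangentSpace n x → ℝ) (u : M → ℝ) : Prop :=
  Dominated (lagrangian H) (criticalValue H) u ∧
  ∀ x : M, ∃ γ : ℝ → M, γ 0 = x ∧
    (∀ T : ℝ, 0 ≤ T → AbsolutelyContinuousOnInterval γ 0 T) ∧
    ForwardCalibrated (lagrangian H) (criticalValue H) u γ

end Curves

end WeakKAM

end

/-! Write V_λ (`discountedValue`) for the infimum of ∫ e^{-λt}(L+c(H)) dt over curves from x. Time
reversal identifies û_λ⁻ with V_λ, and u_λ⁺ = -V_λ, so the point is that V_λ converges uniformly to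
some v for which -v is a forward weak KAM solution.

Compactness. Short curves of bounded Lagrangian make the V_λ equi-Lipschitz
(`exists_lipschitz_value`). They are equibounded because of the choice of c(H): -V_λ is a
subsolution at level c(H) - λ min V_λ, so min V_λ cannot be positive, and subsolutions at levels
close to c(H) bound V_λ from below (`exists_value_le`, `exists_le_value`).

Uniqueness of the limit (`le_of_tendsto_value`). Let v and v' be two limits, and let γ be nearly
optimal for V_λ(x), with λ small on the way to v. Averages along γ against the probability
λe^{-λt}dt play the role of Mather measures. As -v' is a critical subsolution, integration by parts
bounds v'(x) by V_λ(x) plus the average of v' plus a small error. The same computation with V_λ',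
where λ' is fixed and V_λ' is close to v', bounds the average of V_λ' by O(λ). Hence v' ≤ v, and
equality follows by symmetry.

Calibration (`exists_calibrated`). By superlinearity nearly optimal curves are Lipschitz up to O(λ),
so they have a Lipschitz limit γ. Fenchel's inequality with a covector of constant coordinates
integrates to a bound on a difference of endpoint values, which passes to the limit without any
convergence of velocities. Shrinking the time interval and taking the supremum over covectors gives
L+c(H) ≤ (-v∘γ)' almost everywhere (`cost_le_deriv`). Integrating yields one half of calibration;
domination is the other. -/

namespace WeakKAM

/-! ### Charts are locally bilipschitz for the Riemannian distance. -/

section BilipschitzCharts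

open scoped NNReal ENNReal
open Metric Manifold

variable {E : Type*} [NormedAddCommGroup E] [NormedSpace ℝ E]
    {H : Type*} [TopologicalSpace H] (I : ModelWithCorners ℝ E H)
    {M : Type*} [MetricSpace M] [ChartedSpace H M] [IsManifold I 1 M]
    [Bundle.RiemannianBundle (fun x : M => TangentSpace I x)]
    [IsContinuousRiemannianBundle E (fun x : M => TangentSpace I x)]
    [IsRiemannianManifold I M]

attribute [local instance] normedAddCommGroupTangentSpaceVectorSpace
attribute [local instance] normedSpaceTangentSpaceVectorSpace

-- The derivative of the chart is the trivialization of the tangent bundle, whose norm is locally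
-- bounded because the metric is continuous.
omit [IsRiemannianManifold I M] in
lemma eventually_enorm_mfderiv_extChartAt_le (x : M) :
    ∃ C > (0 : ℝ≥0), ∀ᶠ y in 𝓝 x, ∀ v : TangentSpace I y,
      ‖(mfderiv% (extChartAt I x) y v : E)‖ₑ ≤ C * ‖v‖ₑ := by
  obtain ⟨C, hC0, hC⟩ := eventually_norm_trivializationAt_lt E (fun x : M => TangentSpace I x) x
  lift C to ℝ≥0 using hC0.le
  refine ⟨C, by exact_mod_cast hC0, ?_⟩
  filter_upwards [hC, chart_source_mem_nhds H x] with y hy hys v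
  have h1 := (ContinuousLinearMap.le_opNorm _ v).trans
    (mul_le_mul_of_nonneg_right hy.le (norm_nonneg v))
  rw [TangentBundle.continuousLinearMapAt_trivializationAt hys] at h1
  simp only [enorm]
  exact_mod_cast h1

omit [IsRiemannianManifold I M] in
lemma eventually_enorm_mfderivWithin_symm_extChartAt_le (x : M) :
    ∃ C > (0 : ℝ≥0), ∀ᶠ y in 𝓝[range I] (extChartAt I x x), ∀ w : E,
      ‖mfderiv[range I] (extChartAt I x).symm y w‖ₑ ≤ C * ‖w‖ₑ := by
  obtain ⟨C, hC0, hC⟩ := eventually_norm_symmL_trivializationAt_lt E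
    (fun x : M => TangentSpace I x) x
  lift C to ℝ≥0 using hC0.le
  refine ⟨C, by exact_mod_cast hC0, ?_⟩
  have h0 : Tendsto (extChartAt I x).symm (𝓝 (extChartAt I x x)) (𝓝 x) := by
    have := (continuousAt_extChartAt_symm (I := I) x).tendsto
    rwa [extChartAt_to_inv] at this
  filter_upwards [nhdsWithin_le_nhds (h0.eventually hC), extChartAt_target_mem_nhdsWithin x]
    with y hy hyt w
  have hys : (extChartAt I x).symm y ∈ (chartAt H x).source := by
    simpa using (extChartAt I x).map_target hyt
  have h1 := (ContinuousLinearMap.le_opNorm _ w).trans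
    (mul_le_mul_of_nonneg_right hy.le (norm_nonneg w))
  rw [TangentBundle.symmL_trivializationAt hys, (extChartAt I x).right_inv hyt] at h1
  simp only [enorm]
  exact_mod_cast h1

/-- The segment joining the two chart images stays in a convex set where the inverse chart has
derivative at most C. Its lift to the manifold has length at most C times that of the segment. -/
lemma eventually_edist_le_edist_extChartAt (x : M) :
    ∃ C > (0 : ℝ≥0), ∃ U ∈ 𝓝 x, ∀ y ∈ U, ∀ z ∈ U,
      edist y z ≤ C * edist (extChartAt I x y) (extChartAt I x z) := by
  rcases eventually_enorm_mfderivWithin_symm_extChartAt_le I x with ⟨C, C_pos, hC⟩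
  refine ⟨C, C_pos, ?_⟩
  obtain ⟨r, r_pos, hr⟩ : ∃ r > 0,
      ball (extChartAt I x x) r ∩ range I ⊆ (extChartAt I x).target ∩
        {y : E | ∀ w : E, ‖mfderiv[range I] (extChartAt I x).symm y w‖ₑ ≤ C * ‖w‖ₑ} :=
    mem_nhdsWithin_iff.1 (inter_mem (extChartAt_target_mem_nhdsWithin x) hC)
  have A : (extChartAt I x) ⁻¹' (ball (extChartAt I x x) r ∩ range I) ∈ 𝓝 x := by
    apply extChartAt_preimage_mem_nhds_of_mem_nhdsWithin (by simp)
    rw [inter_comm]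
    exact inter_mem_nhdsWithin _ (ball_mem_nhds _ r_pos)
  refine ⟨_, inter_mem A (chart_source_mem_nhds H x), ?_⟩
  rintro y ⟨hy, h'y⟩ z ⟨hz, h'z⟩
  let η := ContinuousAffineMap.lineMap (R := ℝ) (extChartAt I x y) (extChartAt I x z)
  set γ := (extChartAt I x).symm ∘ η
  have hη : Icc 0 1 ⊆ ⇑η ⁻¹' ((extChartAt I x).target ∩
        {y : E | ∀ w : E, ‖mfderiv[range I] (extChartAt I x).symm y w‖ₑ ≤ C * ‖w‖ₑ}) := by
    simp only [← image_subset_iff, ContinuousAffineMap.coe_lineMap_eq,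
     ← segment_eq_image_lineMap, η]
    apply Subset.trans _ hr
    exact ((convex_ball _ _).inter I.convex_range).segment_subset hy hz
  simp only [preimage_inter, subset_inter_iff] at hη
  have η_smooth : CMDiff[Icc 0 1] 1 η := by
    apply ContMDiff.contMDiffOn
    rw [contMDiff_iff_contDiff]
    exact ContinuousAffineMap.contDiff _
  rw [IsRiemannianManifold.out (I := I) y z]
  have : riemannianEDist I y z ≤ pathELength I γ 0 1 := by
    apply riemannianEDist_le_pathELength _ _ _ zero_le_one
    · exact (contMDiffOn_extChartAt_symm x).comp η_smooth hη.1
    · simp [γ, η, ContinuousAffineMap.coe_lineMap_eq, h'y]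
    · simp [γ, η, ContinuousAffineMap.coe_lineMap_eq, h'z]
  apply this.trans
  rw [← lintegral_fderiv_lineMap_eq_edist, pathELength_eq_lintegral_mfderivWithin_Icc,
    ← lintegral_const_mul' _ _ ENNReal.coe_ne_top]
  apply setLIntegral_mono' measurableSet_Icc (fun t ht ↦ ?_)
  have : mfderiv[Icc 0 1] γ t =
      (mfderiv[range I] (extChartAt I x).symm (η t)) ∘L (mfderiv[Icc 0 1] η t) := by
    apply mfderivWithin_comp
    · exact mdifferentiableWithinAt_extChartAt_symm (hη.1 ht)
    · exact η_smooth.mdifferentiableOn one_ne_zero t ht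
    · exact hη.1.trans (preimage_mono (extChartAt_target_subset_range x))
    · rw [uniqueMDiffWithinAt_iff_uniqueDiffWithinAt]
      exact uniqueDiffOn_Icc zero_lt_one t ht
  have : mfderiv[Icc 0 1] γ t 1 =
      (mfderiv[range I] (extChartAt I x).symm (η t)) (mfderiv[Icc 0 1] η t 1) :=
    congr($this 1)
  rw [this]
  refine (hη.2 ht _).trans ?_
  simp only [mfderivWithin_eq_fderivWithin]
  exact le_of_eq rfl

/-- A nearly shortest curve between points of the ball of radius r/3 has length less than 2r/3, so
it stays in the ball of radius r, where the chart has derivative at most C. Its chart image is then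
at most C times as long. -/
lemma eventually_edist_extChartAt_le_edist (x : M) :
    ∃ C > (0 : ℝ≥0), ∃ U ∈ 𝓝 x, ∀ y ∈ U, ∀ z ∈ U,
      edist (extChartAt I x y) (extChartAt I x z) ≤ C * edist y z := by
  rcases eventually_enorm_mfderiv_extChartAt_le I x with ⟨C, C_pos, hC⟩
  obtain ⟨r, r_pos, hr⟩ : ∃ r > 0, Metric.eball x r ⊆
      {y : M | ∀ v : TangentSpace I y, ‖(mfderiv% (extChartAt I x) y v : E)‖ₑ ≤ C * ‖v‖ₑ} ∩
        (extChartAt I x).source :=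
    EMetric.mem_nhds_iff.1 (Filter.inter_mem hC (extChartAt_source_mem_nhds (I := I) x))
  refine ⟨C, C_pos, Metric.eball x (r / 3), Metric.eball_mem_nhds _
    (ENNReal.div_pos r_pos.ne' (by simp)), fun y hy z hz ↦ ?_⟩
  have h3 : r / 3 + (r / 3 + r / 3) = r := by
    rw [← add_assoc, ENNReal.add_thirds]
  have hyz : edist y z < r / 3 + r / 3 :=
    (edist_triangle_right y z x).trans_lt (ENNReal.add_lt_add hy hz)
  suffices H : ∀ c > edist y z, edist (extChartAt I x y) (extChartAt I x z) ≤ C * c by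
    have hC₀ : (C : ℝ≥0∞) ≠ 0 := by simpa using C_pos.ne'
    rw [mul_comm, ← ENNReal.div_le_iff_le_mul (by simp [hC₀]) (by simp)]
    refine le_of_forall_gt_imp_ge_of_dense fun c hc ↦ ?_
    rw [ENNReal.div_le_iff_le_mul (by simp [hC₀]) (by simp), mul_comm]
    exact H c hc
  intro c' hc'
  obtain ⟨c, hc, hcc'⟩ : ∃ c, edist y z < c ∧ c ≤ c' ∧ c ≤ r / 3 + r / 3 :=
    ⟨min c' (r / 3 + r / 3), lt_min hc' hyz, min_le_left _ _, min_le_right _ _⟩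
  refine le_trans ?_ (mul_le_mul_right hcc'.1 _)
  rw [IsRiemannianManifold.out (I := I) y z] at hc
  obtain ⟨γ, γ0, γ1, γ_smooth, hγ, -⟩ := exists_lt_locally_constant_of_riemannianEDist_lt hc
    zero_lt_one
  have hmem : ∀ t ∈ Icc (0 : ℝ) 1, γ t ∈ Metric.eball x r := by
    intro t ht
    have h1 : edist (γ t) y < r / 3 + r / 3 := by
      rw [edist_comm, IsRiemannianManifold.out (I := I) y (γ t)]
      calc riemannianEDist I y (γ t) ≤ pathELength I γ 0 t :=
            riemannianEDist_le_pathELength γ_smooth.contMDiffOn γ0 rfl ht.1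
        _ ≤ pathELength I γ 0 1 := pathELength_mono le_rfl ht.2
        _ < c := hγ
        _ ≤ _ := hcc'.2
    calc edist (γ t) x ≤ edist (γ t) y + edist y x := edist_triangle _ _ _
      _ < (r / 3 + r / 3) + r / 3 := ENNReal.add_lt_add h1 hy
      _ = r := by rw [ENNReal.add_thirds]
  let γ' := extChartAt I x ∘ γ
  have hC' : CMDiff[Icc 0 1] 1 γ' :=
    contMDiffOn_extChartAt.comp (I' := I) (t := (chartAt _ x).source)
      γ_smooth.contMDiffOn (fun t' ht' ↦ by simpa using (hr (hmem t' ht')).2)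
  rw [edist_comm]
  calc edist (extChartAt I x z) (extChartAt I x y)
      = ‖γ' 1 - γ' 0‖ₑ := by rw [edist_eq_enorm_sub]; simp [γ', γ0, γ1]
    _ ≤ ∫⁻ t' in Icc 0 1, ‖derivWithin γ' (Icc 0 1) t'‖ₑ := by
      apply enorm_sub_le_lintegral_derivWithin_Icc_of_contDiffOn_Icc _ zero_le_one
      rwa [← contMDiffOn_iff_contDiffOn]
    _ = ∫⁻ t' in Icc 0 1, ‖mfderiv[Icc 0 1] γ' t' 1‖ₑ := by
      simp_rw [← fderivWithin_derivWithin, mfderivWithin_eq_fderivWithin]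
      rfl
    _ ≤ ∫⁻ t' in Icc 0 1, C * ‖mfderiv[Icc 0 1] γ t' 1‖ₑ := by
      apply setLIntegral_mono' measurableSet_Icc (fun t' ht' ↦ ?_)
      have : mfderiv[Icc 0 1] γ' t' =
          (mfderiv% (extChartAt I x) (γ t')) ∘L (mfderiv[Icc 0 1] γ t') := by
        apply mfderiv_comp_mfderivWithin
        · refine mdifferentiableAt_extChartAt ?_
          simpa using (hr (hmem t' ht')).2
        · exact (γ_smooth.mdifferentiable one_ne_zero).mdifferentiableOn _ ht'
        · rw [uniqueMDiffWithinAt_iff_uniqueDiffWithinAt]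
          exact uniqueDiffOn_Icc zero_lt_one _ ht'
      have : mfderiv[Icc 0 1] γ' t' 1 =
          (mfderiv% (extChartAt I x) (γ t')) (mfderiv[Icc 0 1] γ t' 1) :=
        congr($this 1)
      rw [this]
      exact (hr (hmem t' ht')).1 _
    _ = C * pathELength I γ 0 1 := by
      rw [lintegral_const_mul' _ _ ENNReal.coe_ne_top,
          pathELength_eq_lintegral_mfderivWithin_Icc]
    _ ≤ C * c := by
      gcongr

lemma exists_nhds_bilipschitz_extChartAt (x : M) :
    ∃ C > (0 : ℝ), ∃ U ∈ 𝓝 x, U ⊆ (extChartAt I x).source ∧ ∀ y ∈ U, ∀ z ∈ U,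
      dist y z ≤ C * ‖extChartAt I x y - extChartAt I x z‖ ∧
      ‖extChartAt I x y - extChartAt I x z‖ ≤ C * dist y z := by
  obtain ⟨C₁, hC₁, U₁, hU₁, h₁⟩ := eventually_edist_le_edist_extChartAt I x
  obtain ⟨C₂, hC₂, U₂, hU₂, h₂⟩ := eventually_edist_extChartAt_le_edist I x
  refine ⟨max C₁ C₂, by positivity, _, inter_mem (inter_mem hU₁ hU₂)
    (extChartAt_source_mem_nhds (I := I) x), inter_subset_right, ?_⟩
  rintro y ⟨⟨hy₁, hy₂⟩, -⟩ z ⟨⟨hz₁, hz₂⟩, -⟩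
  have e₁ := h₁ y hy₁ z hz₁
  have e₂ := h₂ y hy₂ z hz₂
  simp only [edist_nndist, ← ENNReal.coe_mul, ENNReal.coe_le_coe, ← NNReal.coe_le_coe,
    NNReal.coe_mul, coe_nndist] at e₁ e₂
  rw [dist_eq_norm (extChartAt I x y)] at e₁ e₂
  constructor
  · exact e₁.trans (by gcongr; exact le_max_left _ _)
  · exact e₂.trans (by gcongr; exact le_max_right _ _)

end BilipschitzCharts
end WeakKAM

/-! ### Hamiltonian, Lagrangian and velocities in coordinates. -/

namespace WeakKAM

section Coordinates

variable {n : ℕ} {M : Type*} [TopologicalSpace M]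
    [ChartedSpace (EuclideanSpace ℝ (Fin n)) M] [IsManifold (𝓡 n) 1 M]

/-- The coordinates of the tangent vectors at `y` in the chart at `x`. -/
noncomputable def tangentCoord (x y : M) : TangentSpace (𝓡 n) y →L[ℝ] EuclideanSpace ℝ (Fin n) :=
  (trivializationAt (EuclideanSpace ℝ (Fin n)) (TangentSpace (𝓡 n)) x).continuousLinearMapAt ℝ y

/-- The covector at `y` with given coordinates in the chart at `x`. -/
noncomputable def cotangentOfCoord (x y : M) (q : EuclideanSpace ℝ (Fin n) →L[ℝ] ℝ) :
    CotangentSpace n y :=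
  q.comp (tangentCoord x y)

lemma surjective_cotangentOfCoord {x y : M}
    (hy : y ∈ (extChartAt (𝓡 n) x).source) :
    Function.Surjective (cotangentOfCoord (n := n) x y) := by
  intro p
  refine ⟨ContinuousLinearMap.comp p ((trivializationAt (EuclideanSpace ℝ (Fin n))
    (TangentSpace (𝓡 n)) x).symmL ℝ y), ?_⟩
  ext v
  change p _ = p v
  congr 1
  exact Bundle.Trivialization.symmL_continuousLinearMapAt _ (by simpa using hy) v

/-- The map is the inverse of a local trivialization of the cotangent bundle. Through it, continuity
of H on the bundle becomes joint continuity of `coordHamiltonian` in the point and the coordinates.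
-/
lemma continuousOn_cotangentOfCoord (x : M) :
    ContinuousOn (fun z : M × (EuclideanSpace ℝ (Fin n) →L[ℝ] ℝ) =>
      (⟨z.1, cotangentOfCoord x z.1 z.2⟩ : CotangentBundle n M))
      ((extChartAt (𝓡 n) x).source ×ˢ univ) := by
  have h := (trivializationAt (EuclideanSpace ℝ (Fin n) →L[ℝ] ℝ)
    (fun x : M => CotangentSpace n x) x).continuousOn_symm
  have hb : (trivializationAt (EuclideanSpace ℝ (Fin n) →L[ℝ] ℝ)
    (fun x : M => CotangentSpace n x) x).baseSet = (extChartAt (𝓡 n) x).source := by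
    simp
  rw [hb] at h
  refine h.congr ?_
  rintro ⟨y, q⟩ ⟨hy, -⟩
  refine congrArg (Bundle.TotalSpace.mk y) ?_
  have h2 := Bundle.Pretrivialization.continuousLinearMap_symm_apply' (RingHom.id ℝ)
    (trivializationAt (EuclideanSpace ℝ (Fin n)) (TangentSpace (𝓡 n)) x)
    (trivializationAt ℝ (Bundle.Trivial M ℝ) x) (b := y) (by simpa using hy) q
  refine Eq.trans ?_ h2.symm
  ext v
  simp [cotangentOfCoord, tangentCoord]

/-- The Hamiltonian read in the chart at `x`. -/
noncomputable def coordHamiltonian (H : (x : M) → CotangentSpace n x → ℝ) (x y : M)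
    (q : EuclideanSpace ℝ (Fin n) →L[ℝ] ℝ) : ℝ :=
  H y (cotangentOfCoord x y q)

/-- Differentiability is not needed: a continuous curve and its coordinate expression are
differentiable at the same times, and elsewhere both sides take the default value 0. -/
lemma tangentCoord_velocity {x : M} {γ : ℝ → M} {t : ℝ} (hγ : ContinuousAt γ t)
    (ht : γ t ∈ (extChartAt (𝓡 n) x).source) :
    tangentCoord x (γ t) (velocity n γ t) = deriv (extChartAt (𝓡 n) x ∘ γ) t := by
  have ht' : γ t ∈ (chartAt (EuclideanSpace ℝ (Fin n)) x).source := by simpa using ht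
  rw [tangentCoord, TangentBundle.continuousLinearMapAt_trivializationAt ht', velocity]
  by_cases hd : MDifferentiableAt 𝓘(ℝ, ℝ) (𝓡 n) γ t
  · have hcomp := mfderiv_comp t (mdifferentiableAt_extChartAt (I := 𝓡 n) ht') hd
    rw [mfderiv_eq_fderiv] at hcomp
    rw [← fderiv_apply_one_eq_deriv]
    exact (congrArg (fun L : ℝ →L[ℝ] EuclideanSpace ℝ (Fin n) => L 1) hcomp).symm
  · rw [mfderiv_zero_of_not_mdifferentiableAt hd]
    have hd' : ¬ DifferentiableAt ℝ (extChartAt (𝓡 n) x ∘ γ) t := by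
      rw [← mdifferentiableAt_iff_differentiableAt]
      exact fun h => hd ((mdifferentiableAt_iff_target_of_mem_source ht').2 ⟨hγ, h⟩)
    rw [deriv_zero_of_not_differentiableAt hd']
    exact map_zero _

end Coordinates

section Superlinear

variable {X F : Type*} [TopologicalSpace X] [NormedAddCommGroup F] [NormedSpace ℝ F]
  [FiniteDimensional ℝ F]

lemma eventually_forall_norm_le_abs_le {h : X → F → ℝ} {x₀ : X}
    (hc : ∀ q, ContinuousAt (Function.uncurry h) (x₀, q)) (ρ : ℝ) :
    ∃ B, ∀ᶠ x in 𝓝 x₀, ∀ q, ‖q‖ ≤ ρ → |h x q| ≤ B := by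
  have : ProperSpace F := FiniteDimensional.proper ℝ F
  have hcont : Continuous (h x₀) := continuous_iff_continuousAt.2 fun q =>
    (hc q).comp (f := fun q => (x₀, q)) (Continuous.prodMk_right x₀).continuousAt
  obtain ⟨B, hB⟩ := (isCompact_closedBall (0 : F) ρ).exists_bound_of_continuousOn
    hcont.continuousOn
  refine ⟨B + 1, ?_⟩
  have := (isCompact_closedBall (0 : F) ρ).eventually_forall_of_forall_eventually (x₀ := x₀)
    (P := fun x q => |h x q| < B + 1) fun q hq =>
      ((hc q).abs).eventually_lt_const (by
        have := hB q hq
        rw [Real.norm_eq_abs] at this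
        simp only [Function.uncurry]
        linarith)
  filter_upwards [this] with x hx q hq
  exact (hx q (by simpa using hq)).le

/-- Superlinearity at one point gives locally uniform superlinearity, by convexity. -/
lemma eventually_mul_norm_sub_le {h : X → F → ℝ} {x₀ : X}
    (hc : ∀ q, ContinuousAt (Function.uncurry h) (x₀, q))
    (hconv : ∀ᶠ x in 𝓝 x₀, ConvexOn ℝ univ (h x))
    (hs : ∀ K : ℝ, ∃ ρ, ∀ q, ρ ≤ ‖q‖ → K * ‖q‖ ≤ h x₀ q) {R : ℝ} (hR : 0 ≤ R) :
    ∃ B, ∀ᶠ x in 𝓝 x₀, ∀ q, R * ‖q‖ - h x q ≤ B := by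
  have : ProperSpace F := FiniteDimensional.proper ℝ F
  obtain ⟨ρ₀, hρ₀⟩ := hs (R + 1)
  set ρ := max ρ₀ (|h x₀ 0| + 1) with hρ
  have hρ1 : |h x₀ 0| + 1 ≤ ρ := le_max_right _ _
  have hρpos : 0 < ρ := by positivity
  obtain ⟨B, hB⟩ := eventually_forall_norm_le_abs_le hc ρ
  refine ⟨R * ρ + B, ?_⟩
  -- At x₀ the gap is at least (R+1)ρ - |h x₀ 0| ≥ Rρ + 1; compactness of the sphere keeps it above
  -- Rρ for nearby x.
  have hsphere := (isCompact_sphere (0 : F) ρ).eventually_forall_of_forall_eventually (x₀ := x₀)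
    (P := fun x q => R * ρ < h x q - h x 0) fun q hq => by
      have h0 : ContinuousAt (fun z : X × F => h z.1 0) (x₀, q) :=
        (hc 0).comp_of_eq (f := fun z : X × F => (z.1, (0 : F))) (by fun_prop) rfl
      have hq' : ‖q‖ = ρ := by simpa using hq
      refine ((hc q).sub h0).eventually_const_lt ?_
      have h1 := hρ₀ q (by rw [hq']; exact le_max_left _ _)
      rw [hq'] at h1
      have h2 := le_abs_self (h x₀ 0)
      change R * ρ < h x₀ q - h x₀ 0
      nlinarith
  filter_upwards [hB, hsphere, hconv] with x hxB hxS hxc q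
  rcases le_or_gt ‖q‖ ρ with hq | hq
  · have := hxB q hq
    have h1 := (abs_le.1 this).1
    have h2 : R * ‖q‖ ≤ R * ρ := by gcongr
    linarith
  · have hqpos : 0 < ‖q‖ := hρpos.trans hq
    set s := ρ / ‖q‖ with hsdef
    have hspos : 0 < s := by positivity
    have hs1 : s ≤ 1 := (div_le_one hqpos).2 hq.le
    have hsq : s * ‖q‖ = ρ := by rw [hsdef]; field_simp
    have h1 := hxS (s • q) (by
      simp [norm_smul, abs_of_pos hspos, hsq])
    -- The segment from 0 to q crosses the sphere at s • q, and convexity propagates the growth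
    -- found there out to q.
    have h2 := hxc.2 (mem_univ q) (mem_univ 0) hspos.le (sub_nonneg.2 hs1) (by ring)
    simp only [smul_zero, add_zero, smul_eq_mul] at h2
    have h3 : s * (R * ‖q‖) ≤ s * (h x q - h x 0) := by
      have : s * (R * ‖q‖) = R * ρ := by rw [← hsq]; ring
      rw [this]
      nlinarith
    have h4 := le_of_mul_le_mul_left h3 hspos
    have h5 := (abs_le.1 (hxB 0 (by simpa using hρpos.le))).1
    have h6 : 0 ≤ R * ρ := by positivity
    linarith

end Superlinear

section LagrangianBounds

variable {n : ℕ} {M : Type*} [TopologicalSpace M]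
    [ChartedSpace (EuclideanSpace ℝ (Fin n)) M] [IsManifold (𝓡 n) 1 M]

/-- Continuity, convexity and superlinearity in the fibers, the latter read in charts. -/
structure ConvexSuperlinear (H : (x : M) → CotangentSpace n x → ℝ) : Prop where
  continuous : Continuous fun q : CotangentBundle n M => H q.proj q.snd
  convexOn : ∀ x : M, ConvexOn ℝ univ (H x)
  superlinear : ∀ (x : M) (K : ℝ), ∃ ρ : ℝ, ∀ q : EuclideanSpace ℝ (Fin n) →L[ℝ] ℝ,
    ρ ≤ ‖q‖ → K * ‖q‖ ≤ coordHamiltonian H x x q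

variable {H : (x : M) → CotangentSpace n x → ℝ}

lemma ConvexSuperlinear.continuousOn_coordHamiltonian (hH : ConvexSuperlinear H) (x : M) :
    ContinuousOn (Function.uncurry (coordHamiltonian H x))
      ((extChartAt (𝓡 n) x).source ×ˢ univ) :=
  hH.continuous.comp_continuousOn (continuousOn_cotangentOfCoord x)

lemma ConvexSuperlinear.continuousAt_coordHamiltonian (hH : ConvexSuperlinear H) {x y : M}
    (hy : y ∈ (extChartAt (𝓡 n) x).source) (q : EuclideanSpace ℝ (Fin n) →L[ℝ] ℝ) :
    ContinuousAt (Function.uncurry (coordHamiltonian H x)) (y, q) :=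
  (hH.continuousOn_coordHamiltonian x).continuousAt
    (prod_mem_nhds ((isOpen_extChartAt_source x).mem_nhds hy) univ_mem)

lemma ConvexSuperlinear.convexOn_coordHamiltonian (hH : ConvexSuperlinear H) (x y : M) :
    ConvexOn ℝ univ (coordHamiltonian H x y) := by
  refine ⟨convex_univ, fun q _ q' _ a b ha hb hab => ?_⟩
  have h := (hH.convexOn y).2 (mem_univ (cotangentOfCoord x y q))
    (mem_univ (cotangentOfCoord x y q')) ha hb hab
  have : cotangentOfCoord x y (a • q + b • q') =
      a • cotangentOfCoord x y q + b • cotangentOfCoord x y q' := by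
    ext v; rfl
  rw [coordHamiltonian, this]
  exact h

lemma lagrangian_eq_iSup_coord {x y : M} (hy : y ∈ (extChartAt (𝓡 n) x).source)
    (v : TangentSpace (𝓡 n) y) :
    lagrangian H y v = ⨆ q : EuclideanSpace ℝ (Fin n) →L[ℝ] ℝ,
      (q (tangentCoord x y v) - coordHamiltonian H x y q) :=
  ((surjective_cotangentOfCoord hy).iSup_comp
    (g := fun p : CotangentSpace n y => (p v - H y p))).symm

/-- Since q w ≤ R‖q‖, locally uniform superlinearity bounds all the Fenchel terms at once. -/
lemma ConvexSuperlinear.eventually_fenchel_le (hH : ConvexSuperlinear H) (x : M) {R : ℝ}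
    (hR : 0 ≤ R) : ∃ B, ∀ᶠ y in 𝓝 x, ∀ w : EuclideanSpace ℝ (Fin n), ‖w‖ ≤ R →
      ∀ q : EuclideanSpace ℝ (Fin n) →L[ℝ] ℝ, q w - coordHamiltonian H x y q ≤ B := by
  obtain ⟨B, hB⟩ := eventually_mul_norm_sub_le
    (hH.continuousAt_coordHamiltonian (mem_extChartAt_source x))
    (Eventually.of_forall (hH.convexOn_coordHamiltonian x)) (hH.superlinear x) hR
  refine ⟨B, hB.mono fun y hy w hw q => le_trans ?_ (hy q)⟩
  have h1 : q w ≤ ‖q‖ * ‖w‖ := (le_abs_self _).trans (q.le_opNorm w)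
  have h2 : ‖q‖ * ‖w‖ ≤ ‖q‖ * R := by gcongr
  linarith

/-- This makes `lagrangian` a genuine supremum; the supremum of an unbounded real family would be 0.
-/
lemma ConvexSuperlinear.bddAbove (hH : ConvexSuperlinear H) (y : M)
    (v : TangentSpace (𝓡 n) y) :
    BddAbove (range fun p : CotangentSpace n y => p v - H y p) := by
  obtain ⟨B, hB⟩ := hH.eventually_fenchel_le y (norm_nonneg (tangentCoord y y v))
  refine ⟨B, ?_⟩
  rintro _ ⟨p, rfl⟩
  obtain ⟨q, rfl⟩ := surjective_cotangentOfCoord (mem_extChartAt_source (I := 𝓡 n) y) p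
  exact hB.self_of_nhds _ le_rfl q

lemma ConvexSuperlinear.apply_sub_le_lagrangian (hH : ConvexSuperlinear H) (x y : M)
    (v : TangentSpace (𝓡 n) y) (q : EuclideanSpace ℝ (Fin n) →L[ℝ] ℝ) :
    q (tangentCoord x y v) - coordHamiltonian H x y q ≤ lagrangian H y v :=
  le_ciSup (hH.bddAbove y v) (cotangentOfCoord x y q)

lemma ConvexSuperlinear.eventually_lagrangian_le (hH : ConvexSuperlinear H) (x : M) {R : ℝ}
    (hR : 0 ≤ R) : ∃ B, ∀ᶠ y in 𝓝 x, ∀ v : TangentSpace (𝓡 n) y, ‖tangentCoord x y v‖ ≤ R →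
      lagrangian H y v ≤ B := by
  obtain ⟨B, hB⟩ := hH.eventually_fenchel_le x hR
  refine ⟨B, ?_⟩
  filter_upwards [hB, extChartAt_source_mem_nhds (I := 𝓡 n) x] with y hy hys v hv
  rw [lagrangian_eq_iSup_coord hys]
  exact ciSup_le (hy _ hv)

/-- The covector K • q, with q a norming functional of the velocity, realizes the slope K, and H is
locally bounded on covectors of norm at most K. -/
lemma ConvexSuperlinear.eventually_le_lagrangian (hH : ConvexSuperlinear H) (x : M) {K : ℝ}
    (hK : 0 ≤ K) : ∃ B, ∀ᶠ y in 𝓝 x, ∀ v : TangentSpace (𝓡 n) y,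
      K * ‖tangentCoord x y v‖ - B ≤ lagrangian H y v := by
  obtain ⟨B, hB⟩ := eventually_forall_norm_le_abs_le
    (hH.continuousAt_coordHamiltonian (mem_extChartAt_source x)) K
  refine ⟨B, hB.mono fun y hy v => ?_⟩
  obtain ⟨q, hq, hqv⟩ := exists_dual_vector'' ℝ (tangentCoord x y v)
  refine le_trans ?_ (hH.apply_sub_le_lagrangian x y v (K • q))
  have h1 : ‖K • q‖ ≤ K := by
    rw [norm_smul, Real.norm_of_nonneg hK]
    exact mul_le_of_le_one_right hK hq
  have h2 := (abs_le.1 (hy _ h1)).2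
  have h3 : (K • q) (tangentCoord x y v) = K * ‖tangentCoord x y v‖ := by
    simp [hqv]
  linarith

/-- For a countable dense set this presents L as a countable supremum, which is what measurability
along curves requires. -/
lemma ConvexSuperlinear.lagrangian_eq_iSup_dense (hH : ConvexSuperlinear H) {x y : M}
    (hy : y ∈ (extChartAt (𝓡 n) x).source) (v : TangentSpace (𝓡 n) y)
    {S : Set (EuclideanSpace ℝ (Fin n) →L[ℝ] ℝ)} (hS : Dense S) :
    lagrangian H y v = ⨆ q : S, ((q : EuclideanSpace ℝ (Fin n) →L[ℝ] ℝ) (tangentCoord x y v) -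
      coordHamiltonian H x y q) := by
  rw [lagrangian_eq_iSup_coord hy]
  refine (hS.ciSup' (f := fun q : EuclideanSpace ℝ (Fin n) →L[ℝ] ℝ =>
    q (tangentCoord x y v) - coordHamiltonian H x y q) ?_).symm
  refine Continuous.sub (by fun_prop) (continuous_iff_continuousAt.2 fun q => ?_)
  exact (hH.continuousAt_coordHamiltonian hy q).comp (f := fun q => (y, q))
    (Continuous.prodMk_right y).continuousAt

variable [CompactSpace M]

lemma ConvexSuperlinear.exists_le_lagrangian (hH : ConvexSuperlinear H) :
    ∃ B, ∀ (y : M) (v : TangentSpace (𝓡 n) y), -B ≤ lagrangian H y v := by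
  have := isCompact_univ.induction_on (X := M)
    (p := fun S => ∃ B, ∀ y ∈ S, ∀ v : TangentSpace (𝓡 n) y, -B ≤ lagrangian H y v)
    ⟨0, by simp⟩ (fun s t hst ⟨B, hB⟩ => ⟨B, fun y hy => hB y (hst hy)⟩)
    (fun s t ⟨B, hB⟩ ⟨B', hB'⟩ => ⟨max B B', fun y hy v => by
      rcases hy with hy | hy
      · linarith [hB y hy v, le_max_left B B']
      · linarith [hB' y hy v, le_max_right B B']⟩)
    (fun x _ => by
      obtain ⟨B, hB⟩ := hH.eventually_le_lagrangian x le_rfl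
      exact ⟨_, mem_nhdsWithin_of_mem_nhds hB, B, fun y hy v => by simpa using hy v⟩)
  simpa using this

lemma ConvexSuperlinear.exists_lagrangian_zero_le (hH : ConvexSuperlinear H) :
    ∃ B, ∀ y : M, lagrangian H y 0 ≤ B := by
  have := isCompact_univ.induction_on (X := M)
    (p := fun S => ∃ B, ∀ y ∈ S, lagrangian H y 0 ≤ B)
    ⟨0, by simp⟩ (fun s t hst ⟨B, hB⟩ => ⟨B, fun y hy => hB y (hst hy)⟩)
    (fun s t ⟨B, hB⟩ ⟨B', hB'⟩ => ⟨max B B', fun y hy => by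
      rcases hy with hy | hy
      · exact (hB y hy).trans (le_max_left _ _)
      · exact (hB' y hy).trans (le_max_right _ _)⟩)
    (fun x _ => by
      obtain ⟨B, hB⟩ := hH.eventually_lagrangian_le x le_rfl
      exact ⟨_, mem_nhdsWithin_of_mem_nhds hB, B, fun y hy => hy 0 (by simp)⟩)
  simpa using this

end LagrangianBounds
end WeakKAM

/-! ### Absolutely continuous maps from an interval to a metric space. -/

section AbsolutelyContinuous

namespace AbsolutelyContinuousOnInterval

variable {X Y Z : Type*} [PseudoMetricSpace X] [PseudoMetricSpace Y] [PseudoMetricSpace Z]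

lemma of_dist_le_mul_add {f : ℝ → X} {g : ℝ → Y} {h : ℝ → Z} {a b C : ℝ}
    (hf : AbsolutelyContinuousOnInterval f a b) (hg : AbsolutelyContinuousOnInterval g a b)
    (H : ∀ s ∈ uIcc a b, ∀ t ∈ uIcc a b,
      dist (h s) (h t) ≤ C * (dist (f s) (f t) + dist (g s) (g t))) :
    AbsolutelyContinuousOnInterval h a b := by
  have hlim := (Tendsto.add hf hg).const_mul C
  simp only [add_zero, mul_zero] at hlim
  refine tendsto_of_tendsto_of_tendsto_of_le_of_le' tendsto_const_nhds hlim
    (Eventually.of_forall fun E => Finset.sum_nonneg fun i _ => dist_nonneg) ?_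
  filter_upwards [mem_inf_of_right (mem_principal_self _)] with E hE
  rw [← Finset.sum_add_distrib, Finset.mul_sum]
  exact Finset.sum_le_sum fun i hi => H _ (hE.1 i hi).1 _ (hE.1 i hi).2

lemma of_dist_le_mul {f : ℝ → X} {h : ℝ → Z} {a b C : ℝ}
    (hf : AbsolutelyContinuousOnInterval f a b)
    (H : ∀ s ∈ uIcc a b, ∀ t ∈ uIcc a b, dist (h s) (h t) ≤ C * dist (f s) (f t)) :
    AbsolutelyContinuousOnInterval h a b := by
  refine of_dist_le_mul_add (C := C / 2) hf hf fun s hs t ht => (H s hs t ht).trans_eq ?_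
  ring

/-- Absolute continuity is tested on finite families of disjoint intervals; such a φ maps these
families to families of the same kind with no greater total length. -/
lemma comp_of_disjoint {f : ℝ → X} {φ : ℝ → ℝ} {a b a' b' : ℝ}
    (hf : AbsolutelyContinuousOnInterval f a' b') (hmaps : MapsTo φ (uIcc a b) (uIcc a' b'))
    (hlip : ∀ s t, dist (φ s) (φ t) ≤ dist s t)
    (hdisj : ∀ s t s' t', Disjoint (uIoc s t) (uIoc s' t') →
      Disjoint (uIoc (φ s) (φ t)) (uIoc (φ s') (φ t'))) :
    AbsolutelyContinuousOnInterval (f ∘ φ) a b := by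
  rw [absolutelyContinuousOnInterval_iff] at hf ⊢
  intro ε hε
  obtain ⟨δ, hδ, h⟩ := hf ε hε
  refine ⟨δ, hδ, fun E hE hEδ => ?_⟩
  refine h (E.1, fun i => (φ (E.2 i).1, φ (E.2 i).2)) ⟨fun i hi => ?_, fun i hi j hj hij => ?_⟩ ?_
  · exact ⟨hmaps (hE.1 i hi).1, hmaps (hE.1 i hi).2⟩
  · exact hdisj _ _ _ _ (hE.2 hi hj hij)
  · exact (Finset.sum_le_sum fun i _ => hlip _ _).trans_lt hEδ

lemma comp_monotone {f : ℝ → X} {φ : ℝ → ℝ} {a b a' b' : ℝ}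
    (hf : AbsolutelyContinuousOnInterval f a' b') (hmaps : MapsTo φ (uIcc a b) (uIcc a' b'))
    (hlip : ∀ s t, dist (φ s) (φ t) ≤ dist s t) (hφ : Monotone φ) :
    AbsolutelyContinuousOnInterval (f ∘ φ) a b := by
  refine hf.comp_of_disjoint hmaps hlip fun s t s' t' h => ?_
  simp only [uIoc, Ioc_disjoint_Ioc] at h ⊢
  simpa only [hφ.map_min, hφ.map_max] using hφ h

lemma comp_antitone {f : ℝ → X} {φ : ℝ → ℝ} {a b a' b' : ℝ}
    (hf : AbsolutelyContinuousOnInterval f a' b') (hmaps : MapsTo φ (uIcc a b) (uIcc a' b'))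
    (hlip : ∀ s t, dist (φ s) (φ t) ≤ dist s t) (hφ : Antitone φ) :
    AbsolutelyContinuousOnInterval (f ∘ φ) a b := by
  refine hf.comp_of_disjoint hmaps hlip fun s t s' t' h => ?_
  simp only [uIoc, Ioc_disjoint_Ioc] at h ⊢
  have := hφ h
  simpa only [hφ.map_min, hφ.map_max, min_comm, max_comm] using this

lemma congr {f g : ℝ → X} {a b : ℝ} (hf : AbsolutelyContinuousOnInterval f a b)
    (hfg : EqOn f g (uIcc a b)) : AbsolutelyContinuousOnInterval g a b :=
  hf.of_dist_le_mul (C := 1) fun s hs t ht => by rw [hfg hs, hfg ht, one_mul]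

/-- Composing with t ↦ min t b and t ↦ max t b freezes f on one side of b. By the triangle
inequality at b, an increment of f is at most the sum of those of the two frozen maps. -/
lemma glue {f : ℝ → X} {a b c : ℝ} (hab : a ≤ b) (hbc : b ≤ c)
    (h₁ : AbsolutelyContinuousOnInterval f a b) (h₂ : AbsolutelyContinuousOnInterval f b c) :
    AbsolutelyContinuousOnInterval f a c := by
  have e₁ : AbsolutelyContinuousOnInterval (f ∘ fun t => min t b) a c := by
    refine h₁.comp_monotone (fun t ht => ?_) (fun s t => ?_) fun s t h => min_le_min_right _ h
    · rw [uIcc_of_le (hab.trans hbc)] at ht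
      rw [uIcc_of_le hab]
      exact ⟨le_min ht.1 hab, min_le_right _ _⟩
    · simpa [Real.dist_eq] using abs_min_sub_min_le_max s b t b
  have e₂ : AbsolutelyContinuousOnInterval (f ∘ fun t => max t b) a c := by
    refine h₂.comp_monotone (fun t ht => ?_) (fun s t => ?_) fun s t h => max_le_max_right _ h
    · rw [uIcc_of_le (hab.trans hbc)] at ht
      rw [uIcc_of_le hbc]
      exact ⟨le_max_right _ _, max_le ht.2 hbc⟩
    · simpa [Real.dist_eq] using abs_max_sub_max_le_max s b t b
  refine of_dist_le_mul_add (C := 1) e₁ e₂ fun s _ t _ => ?_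
  simp only [Function.comp, one_mul]
  rcases le_total s b with hs | hs <;> rcases le_total t b with ht | ht
  · simp [min_eq_left hs, min_eq_left ht]
  · simpa [min_eq_left hs, min_eq_right ht, max_eq_right hs, max_eq_left ht] using
      dist_triangle (f s) (f b) (f t)
  · simpa [min_eq_right hs, min_eq_left ht, max_eq_left hs, max_eq_right ht, add_comm] using
      dist_triangle (f s) (f b) (f t)
  · simp [max_eq_left hs, max_eq_left ht]

lemma comp_add_const {f : ℝ → X} {a b : ℝ} (s : ℝ)
    (hf : AbsolutelyContinuousOnInterval f (a + s) (b + s)) :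
    AbsolutelyContinuousOnInterval (fun t => f (t + s)) a b := by
  refine hf.comp_monotone (φ := fun t => t + s) (fun t ht => ?_) (fun s t => by simp)
    fun _ _ h => by simpa using h
  rcases le_total a b with h | h
  · rw [uIcc_of_le h] at ht
    rw [uIcc_of_le (by linarith)]
    exact ⟨by linarith [ht.1], by linarith [ht.2]⟩
  · rw [uIcc_of_ge h] at ht
    rw [uIcc_of_ge (by linarith)]
    exact ⟨by linarith [ht.1], by linarith [ht.2]⟩

lemma comp_neg {f : ℝ → X} {a b : ℝ} (hf : AbsolutelyContinuousOnInterval f (-a) (-b)) :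
    AbsolutelyContinuousOnInterval (fun t => f (-t)) a b := by
  refine hf.comp_antitone (φ := fun t => -t) (fun t ht => ?_) (fun s t => by simp)
    fun _ _ h => by simpa using h
  rcases le_total a b with h | h
  · rw [uIcc_of_le h] at ht
    rw [uIcc_of_ge (by linarith)]
    exact ⟨by linarith [ht.2], by linarith [ht.1]⟩
  · rw [uIcc_of_ge h] at ht
    rw [uIcc_of_le (by linarith)]
    exact ⟨by linarith [ht.2], by linarith [ht.1]⟩

lemma continuousOn_uIcc {f : ℝ → X} {a b : ℝ} (hf : AbsolutelyContinuousOnInterval f a b) :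
    ContinuousOn f (uIcc a b) := by
  rw [absolutelyContinuousOnInterval_iff] at hf
  intro t ht
  refine Metric.continuousWithinAt_iff.2 fun ε hε => ?_
  obtain ⟨δ, hδ, h⟩ := hf ε hε
  refine ⟨δ, hδ, fun s hs hst => ?_⟩
  simpa using h (1, fun _ => (s, t)) ⟨by simpa using ⟨hs, ht⟩, by simp⟩ (by simpa using hst)

lemma continuousAt {f : ℝ → X} {a b t : ℝ} (hf : AbsolutelyContinuousOnInterval f a b)
    (ht : t ∈ Ioo a b) : ContinuousAt f t := by
  have h : uIcc a b ∈ 𝓝 t := by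
    rw [uIcc_of_le (ht.1.trans ht.2).le]
    exact Icc_mem_nhds ht.1 ht.2
  exact hf.continuousOn_uIcc.continuousAt h

lemma sub_le_integral {f φ : ℝ → ℝ} {a b : ℝ} (hab : a ≤ b)
    (hf : AbsolutelyContinuousOnInterval f a b) (hφ : IntervalIntegrable φ volume a b)
    (h : ∀ᵐ t, t ∈ Ioo a b → deriv f t ≤ φ t) : f b - f a ≤ ∫ t in a..b, φ t := by
  rw [← hf.integral_deriv_eq_sub]
  refine intervalIntegral.integral_mono_ae_restrict hab hf.intervalIntegrable_deriv hφ ?_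
  rw [← restrict_Ioo_eq_restrict_Icc]
  exact (ae_restrict_iff' measurableSet_Ioo).2 h

end AbsolutelyContinuousOnInterval

lemma MeasureTheory.ae_mem_imp_of_locally {P : ℝ → Prop} {s : Set ℝ}
    (h : ∀ t ∈ s, ∃ u ∈ 𝓝 t, ∀ᵐ r, r ∈ u → P r) : ∀ᵐ r, r ∈ s → P r := by
  have : volume {r | r ∈ s ∧ ¬ P r} = 0 := by
    refine measure_null_of_locally_null _ fun t ht => ?_
    obtain ⟨u, hu, hP⟩ := h t ht.1
    refine ⟨u ∩ {r | r ∈ s ∧ ¬ P r}, inter_mem (mem_nhdsWithin_of_mem_nhds hu)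
      self_mem_nhdsWithin, ?_⟩
    refine measure_mono_null ?_ (ae_iff.1 hP)
    exact fun r hr => by simpa using ⟨hr.1, hr.2.2⟩
  rw [ae_iff]
  simpa using this

lemma HasDerivAt.norm_le_mul_norm {E F : Type*} [NormedAddCommGroup E] [NormedSpace ℝ E]
    [NormedAddCommGroup F] [NormedSpace ℝ F] {f : ℝ → E} {g : ℝ → F} {f' : E} {g' : F} {t C : ℝ}
    (hf : HasDerivAt f f' t) (hg : HasDerivAt g g' t)
    (h : ∀ᶠ s in 𝓝 t, ‖f s - f t‖ ≤ C * ‖g s - g t‖) : ‖f'‖ ≤ C * ‖g'‖ := by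
  refine le_of_tendsto_of_tendsto hf.tendsto_slope.norm (hg.tendsto_slope.norm.const_mul C) ?_
  filter_upwards [nhdsWithin_le_nhds h] with s hs
  rw [slope_def_module, slope_def_module, norm_smul, norm_smul]
  calc ‖(s - t)⁻¹‖ * ‖f s - f t‖ ≤ ‖(s - t)⁻¹‖ * (C * ‖g s - g t‖) := by gcongr
    _ = _ := by ring

end AbsolutelyContinuous

/-! ### Differentiability, measurability and integrability along curves in M. -/

namespace WeakKAM

section Curves

variable {n : ℕ} {M : Type*} [MetricSpace M]
    [ChartedSpace (EuclideanSpace ℝ (Fin n)) M] [IsManifold (𝓡 n) 1 M]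

/-- Every chart is bilipschitz near its base point. -/
def BilipschitzCharts (n : ℕ) (M : Type*) [MetricSpace M]
    [ChartedSpace (EuclideanSpace ℝ (Fin n)) M] : Prop :=
  ∀ x : M, ∃ C > (0 : ℝ), ∃ U ∈ 𝓝 x, U ⊆ (extChartAt (𝓡 n) x).source ∧ ∀ y ∈ U, ∀ z ∈ U,
    dist y z ≤ C * ‖extChartAt (𝓡 n) x y - extChartAt (𝓡 n) x z‖ ∧
    ‖extChartAt (𝓡 n) x y - extChartAt (𝓡 n) x z‖ ≤ C * dist y z

lemma mdifferentiableAt_of_extChartAt_comp {γ : ℝ → M} {t : ℝ} {x : M}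
    (hγ : ContinuousAt γ t) (hx : γ t ∈ (extChartAt (𝓡 n) x).source)
    (hd : DifferentiableAt ℝ (extChartAt (𝓡 n) x ∘ γ) t) :
    MDifferentiableAt 𝓘(ℝ, ℝ) (𝓡 n) γ t :=
  (mdifferentiableAt_iff_target_of_mem_source (by simpa using hx)).2
    ⟨hγ, mdifferentiableAt_iff_differentiableAt.2 hd⟩

lemma differentiableAt_extChartAt_comp {γ : ℝ → M} {t : ℝ} {x : M}
    (hγ : MDifferentiableAt 𝓘(ℝ, ℝ) (𝓡 n) γ t) (hx : γ t ∈ (extChartAt (𝓡 n) x).source) :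
    DifferentiableAt ℝ (extChartAt (𝓡 n) x ∘ γ) t :=
  mdifferentiableAt_iff_differentiableAt.1
    ((mdifferentiableAt_iff_target_of_mem_source (by simpa using hx)).1 hγ).2

/-- Locally, a bilipschitz chart turns γ into an absolutely continuous Euclidean curve, which has
bounded variation and so is differentiable almost everywhere. -/
lemma ae_mdifferentiableAt (hM : BilipschitzCharts n M) {γ : ℝ → M} {a b : ℝ}
    (hγ : AbsolutelyContinuousOnInterval γ a b) :
    ∀ᵐ t, t ∈ Ioo a b → MDifferentiableAt 𝓘(ℝ, ℝ) (𝓡 n) γ t := by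
  rcases le_or_gt b a with hab | hab
  · simp [Ioo_eq_empty hab.not_gt]
  refine ae_mem_imp_of_locally fun t ht => ?_
  have hcont : ∀ s ∈ Ioo a b, ContinuousAt γ s := fun s hs => hγ.continuousAt hs
  obtain ⟨C, -, U, hU, hUs, hbi⟩ := hM (γ t)
  obtain ⟨ε, hε, hsub⟩ := Metric.mem_nhds_iff.1
    (inter_mem (Ioo_mem_nhds ht.1 ht.2) (hcont t ht hU))
  have hI : uIcc (t - ε / 2) (t + ε / 2) ⊆ Metric.ball t ε := by
    intro s hs
    rw [uIcc_of_le (by linarith)] at hs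
    rw [Metric.mem_ball, Real.dist_eq, abs_lt]
    constructor <;> linarith [hs.1, hs.2]
  have hAC : AbsolutelyContinuousOnInterval (extChartAt (𝓡 n) (γ t) ∘ γ)
      (t - ε / 2) (t + ε / 2) := by
    refine AbsolutelyContinuousOnInterval.of_dist_le_mul (C := C) (hγ.mono (fun s hs => ?_))
      fun s hs r hr => ?_
    · rw [uIcc_of_le hab.le]
      exact Ioo_subset_Icc_self (hsub (hI hs)).1
    · rw [dist_eq_norm]
      exact (hbi _ (hsub (hI hs)).2 _ (hsub (hI hr)).2).2
  refine ⟨Icc (t - ε / 2) (t + ε / 2), Icc_mem_nhds (by linarith) (by linarith), ?_⟩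
  rw [← uIcc_of_le (by linarith)]
  filter_upwards [hAC.boundedVariationOn.ae_differentiableAt_of_mem_uIcc] with s hs hsI
  exact mdifferentiableAt_of_extChartAt_comp (hcont s (hsub (hI hsI)).1)
    (hUs (hsub (hI hsI)).2) (hs hsI)

variable {H : (x : M) → CotangentSpace n x → ℝ}

/-- On each of finitely many open sets of times where γ lies in a chart, L(γ,γ') is a countable
supremum of measurable functions: a functional of the derivative minus a continuous term. -/
lemma ConvexSuperlinear.aemeasurable_lagrangian [CompactSpace M] (hH : ConvexSuperlinear H)
    {γ : ℝ → M} {a b : ℝ} (hγ : ContinuousOn γ (Ioo a b)) :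
    AEMeasurable (fun t => lagrangian H (γ t) (velocity n γ t)) (volume.restrict (Ioo a b)) := by
  obtain ⟨S, hS⟩ := CompactSpace.elim_nhds_subcover (fun x : M => (extChartAt (𝓡 n) x).source)
    fun x => extChartAt_source_mem_nhds x
  set V : S → Set ℝ := fun x => Ioo a b ∩ γ ⁻¹' (extChartAt (𝓡 n) (x : M)).source with hV
  have hVo : ∀ x, IsOpen (V x) := fun x =>
    hγ.isOpen_inter_preimage isOpen_Ioo (isOpen_extChartAt_source _)
  have hcover : ⋃ x, V x = Ioo a b := by
    refine Subset.antisymm (iUnion_subset fun x => inter_subset_left) fun t ht => ?_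
    have h1 : γ t ∈ ⋃ x ∈ S, (extChartAt (𝓡 n) x).source := hS ▸ mem_univ _
    simp only [mem_iUnion] at h1 ⊢
    obtain ⟨x, hx, hxt⟩ := h1
    exact ⟨⟨x, hx⟩, ht, hxt⟩
  rw [← hcover, aemeasurable_iUnion_iff]
  intro x
  obtain ⟨D, hDc, hD⟩ := TopologicalSpace.exists_countable_dense
    (EuclideanSpace ℝ (Fin n) →L[ℝ] ℝ)
  have := hDc.to_subtype
  have hmeas : AEMeasurable (fun t => ⨆ q : D, ((q : EuclideanSpace ℝ (Fin n) →L[ℝ] ℝ)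
      (deriv (extChartAt (𝓡 n) (x : M) ∘ γ) t) - coordHamiltonian H x (γ t) q))
      (volume.restrict (V x)) := by
    refine AEMeasurable.iSup fun q => AEMeasurable.sub ?_ ?_
    · exact ((q : EuclideanSpace ℝ (Fin n) →L[ℝ] ℝ).measurable.comp
        (measurable_deriv _)).aemeasurable
    · refine ContinuousOn.aemeasurable ?_ (hVo x).measurableSet
      exact (hH.continuousOn_coordHamiltonian (x : M)).comp
        ((hγ.mono inter_subset_left).prodMk continuousOn_const) fun t ht => ⟨ht.2, mem_univ _⟩
  refine hmeas.congr ?_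
  refine (ae_restrict_iff' (hVo x).measurableSet).2 (Eventually.of_forall fun t ht => ?_)
  beta_reduce
  rw [hH.lagrangian_eq_iSup_dense ht.2 _ hD,
    tangentCoord_velocity (hγ.continuousAt (isOpen_Ioo.mem_nhds ht.1)) ht.2]

/-- As L is bounded below, an integrable upper bound suffices. -/
lemma ConvexSuperlinear.intervalIntegrable_lagrangian [CompactSpace M]
    (hH : ConvexSuperlinear H) {γ : ℝ → M} {a b : ℝ} (hab : a ≤ b)
    (hγ : ContinuousOn γ (Ioo a b)) {g : ℝ → ℝ} (hg : IntervalIntegrable g volume a b)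
    (h : ∀ᵐ t, t ∈ Ioo a b → lagrangian H (γ t) (velocity n γ t) ≤ g t) :
    IntervalIntegrable (fun t => lagrangian H (γ t) (velocity n γ t)) volume a b := by
  obtain ⟨B, hB⟩ := hH.exists_le_lagrangian
  rw [intervalIntegrable_iff_integrableOn_Ioo_of_le hab] at hg ⊢
  refine Integrable.mono' (hg.norm.add (integrable_const |B|))
    (hH.aemeasurable_lagrangian hγ).aestronglyMeasurable ?_
  filter_upwards [(ae_restrict_iff' measurableSet_Ioo).2 h] with t ht
  have h1 := hB (γ t) (velocity n γ t)
  simp only [Pi.add_apply, Real.norm_eq_abs]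
  rw [abs_le]
  constructor
  · linarith [le_abs_self B, abs_nonneg (g t)]
  · linarith [le_abs_self (g t), abs_nonneg B]

end Curves
end WeakKAM

/-! ### Action estimates: superlinear lower bounds, short curves, Lipschitz subsolutions. -/

namespace WeakKAM

section Curves

variable {n : ℕ} {M : Type*} [MetricSpace M] [CompactSpace M]
    [ChartedSpace (EuclideanSpace ℝ (Fin n)) M] [IsManifold (𝓡 n) 1 M]
    {H : (x : M) → CotangentSpace n x → ℝ}

/-- The distance to z changes at most C times as fast as the coordinates of γ move, and L grows at
least with slope K * C in the coordinate velocity. Compactness makes B uniform. -/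
lemma ConvexSuperlinear.exists_mul_deriv_dist_le (hH : ConvexSuperlinear H)
    (hM : BilipschitzCharts n M) {K : ℝ} (hK : 0 ≤ K) :
    ∃ B, ∀ (γ : ℝ → M) (t : ℝ), MDifferentiableAt 𝓘(ℝ, ℝ) (𝓡 n) γ t → ∀ (z : M) (f' : ℝ),
      HasDerivAt (fun s => dist z (γ s)) f' t →
        K * f' ≤ lagrangian H (γ t) (velocity n γ t) + B := by
  have := isCompact_univ.induction_on (X := M)
    (p := fun S => ∃ B, ∀ (γ : ℝ → M) (t : ℝ), γ t ∈ S →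
      MDifferentiableAt 𝓘(ℝ, ℝ) (𝓡 n) γ t → ∀ (z : M) (f' : ℝ),
      HasDerivAt (fun s => dist z (γ s)) f' t →
        K * f' ≤ lagrangian H (γ t) (velocity n γ t) + B)
    ⟨0, by simp⟩ (fun s t hst ⟨B, hB⟩ => ⟨B, fun γ t ht => hB γ t (hst ht)⟩)
    (fun s t ⟨B, hB⟩ ⟨B', hB'⟩ => ⟨max B B', fun γ t ht hd z f' hf => by
      rcases ht with ht | ht
      · linarith [hB γ t ht hd z f' hf, le_max_left B B']
      · linarith [hB' γ t ht hd z f' hf, le_max_right B B']⟩)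
    (fun x _ => by
      obtain ⟨C, hC, U, hU, hUs, hbi⟩ := hM x
      obtain ⟨B, hB⟩ := hH.eventually_le_lagrangian x (mul_nonneg hK hC.le)
      refine ⟨_, mem_nhdsWithin_of_mem_nhds (inter_mem (interior_mem_nhds.2 hU) hB), B,
        fun γ t ht hd z f' hf => ?_⟩
      have hγU : ∀ᶠ s in 𝓝 t, γ s ∈ U :=
        hd.continuousAt.eventually (mem_interior_iff_mem_nhds.1 ht.1)
      have hsrc := hUs hγU.self_of_nhds
      have h1 := hf.norm_le_mul_norm (differentiableAt_extChartAt_comp hd hsrc).hasDerivAt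
        (C := C) (hγU.mono fun s hs => by
          refine le_trans ?_ (hbi _ hs _ hγU.self_of_nhds).1
          rw [Real.norm_eq_abs, abs_le]
          constructor
          · linarith [dist_triangle z (γ s) (γ t)]
          · linarith [dist_triangle z (γ t) (γ s), dist_comm (γ s) (γ t)])
      rw [← tangentCoord_velocity hd.continuousAt hsrc] at h1
      have h2 := ht.2 (velocity n γ t)
      have h3 : K * f' ≤ K * (C * ‖tangentCoord x (γ t) (velocity n γ t)‖) := by
        gcongr
        exact (le_abs_self _).trans h1
      linarith)
  simpa using this

/-- Superlinearity: the action controls every multiple of the distance. -/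
lemma ConvexSuperlinear.exists_mul_dist_le_integral (hH : ConvexSuperlinear H)
    (hM : BilipschitzCharts n M) {K : ℝ} (hK : 0 ≤ K) :
    ∃ B, ∀ (γ : ℝ → M) (a b : ℝ), a ≤ b → AbsolutelyContinuousOnInterval γ a b →
      IntervalIntegrable (fun t => lagrangian H (γ t) (velocity n γ t)) volume a b →
      K * dist (γ a) (γ b) ≤ ∫ t in a..b, (lagrangian H (γ t) (velocity n γ t) + B) := by
  obtain ⟨B, hB⟩ := hH.exists_mul_deriv_dist_le hM hK
  refine ⟨B, fun γ a b hab hγ hint => ?_⟩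
  have hf : AbsolutelyContinuousOnInterval (fun t => dist (γ a) (γ t)) a b :=
    hγ.of_dist_le_mul (C := 1) fun s _ t _ => by
      rw [one_mul, Real.dist_eq, abs_le]
      constructor
      · linarith [dist_triangle (γ a) (γ s) (γ t)]
      · linarith [dist_triangle (γ a) (γ t) (γ s), dist_comm (γ s) (γ t)]
  have h := (hf.const_mul K).sub_le_integral hab (hint.add intervalIntegrable_const) (by
    filter_upwards [ae_mdifferentiableAt hM hγ, hf.ae_differentiableAt] with t h1 h2 ht
    have h3 := (h2 (by rw [uIcc_of_le hab]; exact Ioo_subset_Icc_self ht)).hasDerivAt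
    rw [(h3.const_mul K).deriv]
    exact hB γ t (h1 ht) _ _ h3)
  simpa using h

/-- Nearby points are joined by short curves of bounded Lagrangian. -/
lemma ConvexSuperlinear.exists_short_curve (hH : ConvexSuperlinear H)
    (hM : BilipschitzCharts n M) :
    ∃ δ > (0 : ℝ), ∃ C₁ C₂ : ℝ, ∀ y z : M, dist y z < δ → ∃ T : ℝ, 0 ≤ T ∧ T ≤ C₂ * dist y z ∧
      ∃ σ : ℝ → M, σ 0 = y ∧ σ T = z ∧ AbsolutelyContinuousOnInterval σ 0 T ∧
        ∀ t ∈ Ioo 0 T, lagrangian H (σ t) (velocity n σ t) ≤ C₁ := by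
  have := isCompact_univ.induction_on (X := M)
    (p := fun S => ∃ δ > (0 : ℝ), ∃ C₁ C₂ : ℝ, ∀ y ∈ S, ∀ z : M, dist y z < δ →
      ∃ T : ℝ, 0 ≤ T ∧ T ≤ C₂ * dist y z ∧
      ∃ σ : ℝ → M, σ 0 = y ∧ σ T = z ∧ AbsolutelyContinuousOnInterval σ 0 T ∧
        ∀ t ∈ Ioo 0 T, lagrangian H (σ t) (velocity n σ t) ≤ C₁)
    ⟨1, one_pos, by simp⟩ (fun s t hst ⟨δ, hδ, C₁, C₂, h⟩ =>
      ⟨δ, hδ, C₁, C₂, fun y hy => h y (hst hy)⟩)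
    (fun s t ⟨δ, hδ, C₁, C₂, h⟩ ⟨δ', hδ', C₁', C₂', h'⟩ =>
      ⟨min δ δ', lt_min hδ hδ', max C₁ C₁', max C₂ C₂', fun y hy z hyz => by
        rcases hy with hy | hy
        · obtain ⟨T, h0, hT, σ, hσ⟩ := h y hy z (hyz.trans_le (min_le_left _ _))
          exact ⟨T, h0, hT.trans (by gcongr; exact le_max_left _ _), σ, hσ.1, hσ.2.1, hσ.2.2.1,
            fun t ht => (hσ.2.2.2 t ht).trans (le_max_left _ _)⟩
        · obtain ⟨T, h0, hT, σ, hσ⟩ := h' y hy z (hyz.trans_le (min_le_right _ _))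
          exact ⟨T, h0, hT.trans (by gcongr; exact le_max_right _ _), σ, hσ.1, hσ.2.1, hσ.2.2.1,
            fun t ht => (hσ.2.2.2 t ht).trans (le_max_right _ _)⟩⟩)
    (fun x _ => by
      obtain ⟨C, hC, U, hU, hUs, hbi⟩ := hM x
      obtain ⟨B, hB⟩ := hH.eventually_lagrangian_le x zero_le_one
      set e := extChartAt (𝓡 n) x
      obtain ⟨r, hr, hrsub⟩ : ∃ r > 0, Metric.ball (e x) r ⊆ e.target ∩ e.symm ⁻¹' (U ∩
          {y | ∀ v : TangentSpace (𝓡 n) y, ‖tangentCoord x y v‖ ≤ 1 → lagrangian H y v ≤ B}) :=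
        Metric.mem_nhds_iff.1 (inter_mem (extChartAt_target_mem_nhds x)
          (extChartAt_preimage_mem_nhds (inter_mem hU hB)))
      have hV : U ∩ e ⁻¹' Metric.ball (e x) r ∈ 𝓝 x := inter_mem hU
        ((continuousAt_extChartAt x).preimage_mem_nhds (Metric.ball_mem_nhds _ hr))
      obtain ⟨ρ, hρ, hρsub⟩ := Metric.mem_nhds_iff.1 hV
      refine ⟨Metric.ball x (ρ / 2), mem_nhdsWithin_of_mem_nhds (Metric.ball_mem_nhds _
        (half_pos hρ)), ρ / 2, half_pos hρ, B, C, fun y hy z hyz => ?_⟩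
      have hyV := hρsub (Metric.ball_subset_ball (by linarith) hy)
      have hzV : z ∈ U ∩ e ⁻¹' Metric.ball (e x) r := hρsub (by
        rw [Metric.mem_ball] at hy ⊢
        linarith [dist_triangle z y x, dist_comm y z])
      -- The curve is the chart segment run at unit coordinate speed, so its duration is its
      -- coordinate length. If the endpoints coincide, then T = 0 and w = 0.
      set T := ‖e z - e y‖ with hT
      set w := T⁻¹ • (e z - e y) with hw
      have hTw : T • w = e z - e y := by
        rcases eq_or_ne T 0 with h0 | h0
        · rw [h0, zero_smul, eq_comm, ← norm_eq_zero, ← hT, h0]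
        · rw [hw, smul_inv_smul₀ h0]
      have hwn : ‖w‖ ≤ 1 := by
        rw [hw, norm_smul, norm_inv, hT, norm_norm]
        exact inv_mul_le_one
      have hmem : ∀ t ∈ Icc 0 T, e y + t • w ∈ Metric.ball (e x) r := by
        intro t ht
        rw [hw, smul_smul]
        refine (convex_ball (e x) r).add_smul_sub_mem hyV.2 hzV.2 ⟨?_, ?_⟩
        · exact mul_nonneg ht.1 (inv_nonneg.2 (norm_nonneg _))
        · exact mul_inv_le_one_of_le₀ ht.2 (norm_nonneg _)
      have hright : ∀ t ∈ Icc 0 T, e (e.symm (e y + t • w)) = e y + t • w := fun t ht =>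
        e.right_inv (hrsub (hmem t ht)).1
      have hAC : AbsolutelyContinuousOnInterval (fun t => e.symm (e y + t • w)) 0 T := by
        refine AbsolutelyContinuousOnInterval.of_dist_le_mul (f := fun t : ℝ => t) (C := C)
          LipschitzWith.id.lipschitzOnWith.absolutelyContinuousOnInterval fun s hs t ht => ?_
        rw [uIcc_of_le (norm_nonneg _)] at hs ht
        refine ((hbi _ (hrsub (hmem s hs)).2.1 _ (hrsub (hmem t ht)).2.1).1).trans ?_
        rw [hright s hs, hright t ht, add_sub_add_left_eq_sub, ← sub_smul, norm_smul,
          Real.dist_eq, Real.norm_eq_abs]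
        gcongr
        exact mul_le_of_le_one_right (abs_nonneg _) hwn
      refine ⟨T, norm_nonneg _, ?_, fun t => e.symm (e y + t • w), ?_, ?_, hAC, fun t ht => ?_⟩
      · rw [hT, norm_sub_rev]
        exact (hbi y hyV.1 z hzV.1).2
      · simpa using e.left_inv (hUs hyV.1)
      · simpa [hTw] using e.left_inv (hUs hzV.1)
      · have htI := Ioo_subset_Icc_self ht
        refine (hrsub (hmem t htI)).2.2 _ ?_
        have hσ := hAC.continuousAt ht
        have hsrc := hUs (hrsub (hmem t htI)).2.1
        rw [tangentCoord_velocity (x := x) (γ := fun t => e.symm (e y + t • w)) hσ hsrc]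
        have hd : HasDerivAt (e ∘ fun t => e.symm (e y + t • w)) w t := by
          have h1 : HasDerivAt (fun t : ℝ => e y + t • w) w t := by
            simpa using ((hasDerivAt_id t).smul_const w).const_add (e y)
          refine h1.congr_of_eventuallyEq ?_
          filter_upwards [isOpen_Ioo.mem_nhds ht] with s hs
          exact hright s (Ioo_subset_Icc_self hs)
        rw [hd.deriv]
        exact hwn)
  simpa using this

/-- The points x at which f x - f x₀ is bounded uniformly over the whole family are stable under
steps shorter than δ, so they form a clopen set, hence all of M. Compactness makes the bound uniform
in x. -/
lemma exists_forall_abs_sub_le {M : Type*} [MetricSpace M] [CompactSpace M] [ConnectedSpace M]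
    {δ : ℝ} (hδ : 0 < δ) (C : ℝ) : ∃ B : ℝ, ∀ f : M → ℝ,
      (∀ y z, dist y z < δ → |f y - f z| ≤ C * dist y z) → ∀ x y, |f x - f y| ≤ B := by
  obtain ⟨x₀⟩ := (inferInstance : Nonempty M)
  set 𝓕 := {f : M → ℝ | ∀ y z, dist y z < δ → |f y - f z| ≤ C * dist y z} with h𝓕
  have hstep : ∀ f ∈ 𝓕, ∀ y z, dist y z < δ → |f y - f z| ≤ |C| * δ := fun f hf y z hyz =>
    (hf y z hyz).trans (mul_le_mul (le_abs_self _) hyz.le dist_nonneg (abs_nonneg _))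
  set S := {x : M | ∃ B, ∀ f ∈ 𝓕, |f x - f x₀| ≤ B} with hS
  have hnear : ∀ x ∈ S, ∀ y, dist x y < δ → y ∈ S := by
    rintro x ⟨B, hB⟩ y hxy
    refine ⟨|C| * δ + B, fun f hf => ?_⟩
    have := abs_sub_le (f y) (f x) (f x₀)
    linarith [hB f hf, hstep f hf y x (by rwa [dist_comm])]
  have hclopen : IsClopen S := by
    refine ⟨⟨Metric.isOpen_iff.2 fun x hx => ⟨δ, hδ, fun y hy hyS => hx ?_⟩⟩,
      Metric.isOpen_iff.2 fun x hx => ⟨δ, hδ, fun y hy => ?_⟩⟩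
    · exact hnear y hyS x (Metric.mem_ball.1 hy)
    · exact hnear x hx y (by rw [dist_comm]; exact hy)
  have hSu : S = univ := hclopen.eq_univ ⟨x₀, 0, fun f _ => by simp⟩
  have := isCompact_univ.induction_on (X := M)
    (p := fun A => ∃ B, ∀ x ∈ A, ∀ f ∈ 𝓕, |f x - f x₀| ≤ B)
    ⟨0, by simp⟩ (fun s t hst ⟨B, hB⟩ => ⟨B, fun y hy => hB y (hst hy)⟩)
    (fun s t ⟨B, hB⟩ ⟨B', hB'⟩ => ⟨max B B', fun y hy f hf => by
      rcases hy with hy | hy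
      · exact (hB y hy f hf).trans (le_max_left _ _)
      · exact (hB' y hy f hf).trans (le_max_right _ _)⟩)
    (fun x _ => by
      obtain ⟨B, hB⟩ : x ∈ S := hSu ▸ mem_univ x
      refine ⟨Metric.ball x δ, mem_nhdsWithin_of_mem_nhds (Metric.ball_mem_nhds _ hδ),
        |C| * δ + B, fun y hy f hf => ?_⟩
      have := abs_sub_le (f y) (f x) (f x₀)
      linarith [hB f hf, hstep f hf y x hy])
  obtain ⟨B, hB⟩ := this
  refine ⟨B + B, fun f hf x y => ?_⟩
  have := abs_sub_le (f x) (f x₀) (f y)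
  linarith [hB x (mem_univ _) f hf, hB y (mem_univ _) f hf, abs_sub_comm (f x₀) (f y)]

lemma exists_forall_abs_sub_le_mul_dist {M : Type*} [MetricSpace M] [CompactSpace M]
    [ConnectedSpace M] {δ : ℝ} (hδ : 0 < δ) (C : ℝ) : ∃ B : ℝ, ∀ f : M → ℝ,
      (∀ y z, dist y z < δ → |f y - f z| ≤ C * dist y z) →
        ∀ x y, |f x - f y| ≤ B * dist x y := by
  obtain ⟨B, hB⟩ := exists_forall_abs_sub_le (M := M) hδ C
  -- For points at distance at least δ, the oscillation bound B is itself at most (|B| / δ) * dist x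
  -- y.
  refine ⟨max C (|B| / δ), fun f hf x y => ?_⟩
  rcases lt_or_ge (dist x y) δ with h | h
  · exact (hf x y h).trans (by gcongr; exact le_max_left _ _)
  · calc |f x - f y| ≤ |B| := (hB f hf x y).trans (le_abs_self _)
      _ = |B| / δ * δ := by field_simp
      _ ≤ max C (|B| / δ) * dist x y := by
        gcongr
        exact le_max_right _ _

lemma ConvexSuperlinear.intervalIntegrable_of_le (hH : ConvexSuperlinear H) {σ : ℝ → M}
    {T C : ℝ} (hT : 0 ≤ T) (hσ : AbsolutelyContinuousOnInterval σ 0 T)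
    (h : ∀ t ∈ Ioo 0 T, lagrangian H (σ t) (velocity n σ t) ≤ C) :
    IntervalIntegrable (fun t => lagrangian H (σ t) (velocity n σ t)) volume 0 T :=
  hH.intervalIntegrable_lagrangian hT (fun _ ht => (hσ.continuousAt ht).continuousWithinAt)
    (g := fun _ => C) intervalIntegrable_const (Eventually.of_forall h)

/-- Apply domination along the short curves between nearby points, in both directions. The constant
is uniform over all levels c ≤ c₀. -/
lemma ConvexSuperlinear.exists_lipschitz_of_dominated [ConnectedSpace M]
    (hH : ConvexSuperlinear H) (hM : BilipschitzCharts n M) (c₀ : ℝ) :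
    ∃ B : ℝ, ∀ c ≤ c₀, ∀ w : M → ℝ, Dominated (lagrangian H) c w →
      ∀ x y, |w x - w y| ≤ B * dist x y := by
  obtain ⟨δ, hδ, C₁, C₂, hcurve⟩ := hH.exists_short_curve hM
  obtain ⟨B, hB⟩ := exists_forall_abs_sub_le_mul_dist (M := M) hδ (|C₁ + c₀| * C₂)
  refine ⟨B, fun c hc w hw => hB w ?_⟩
  have key : ∀ y z, dist y z < δ → w z - w y ≤ |C₁ + c₀| * C₂ * dist y z := by
    intro y z hyz
    obtain ⟨T, hT0, hT, σ, hσ0, hσT, hAC, hσ⟩ := hcurve y z hyz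
    have hint := (hH.intervalIntegrable_of_le hT0 hAC hσ).add
      (intervalIntegrable_const (c := c))
    have h1 := hw 0 T σ hT0 hAC hint
    rw [hσ0, hσT] at h1
    have h2 : ∫ t in (0 : ℝ)..T, (lagrangian H (σ t) (velocity n σ t) + c) ≤
        ∫ _ in (0 : ℝ)..T, |C₁ + c₀| := by
      refine intervalIntegral.integral_mono_on_of_le_Ioo hT0 hint intervalIntegrable_const
        fun t ht => ?_
      linarith [hσ t ht, le_abs_self (C₁ + c₀)]
    rw [intervalIntegral.integral_const, sub_zero, smul_eq_mul] at h2
    calc w z - w y ≤ T * |C₁ + c₀| := h1.trans h2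
      _ ≤ (C₂ * dist y z) * |C₁ + c₀| := by gcongr
      _ = _ := by ring
  intro y z hyz
  rw [abs_le]
  have h1 := key y z hyz
  have h2 := key z y (by rwa [dist_comm])
  rw [dist_comm] at h2
  constructor <;> linarith

end Curves
end WeakKAM

/-! ### Half-line integrals and the discounted action: shift, reversal and concatenation. -/

namespace MeasureTheory

lemma setIntegral_Ioi_comp_add_right (f : ℝ → ℝ) (s : ℝ) :
    ∫ t in Ioi (0 : ℝ), f (t + s) = ∫ t in Ioi s, f t := by
  have h := (measurePreserving_add_right volume s).setIntegral_preimage_emb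
    (measurableEmbedding_addRight s) f (Ioi s)
  simpa using h

lemma integrableOn_Ioi_comp_add_right_iff {f : ℝ → ℝ} {s : ℝ} :
    IntegrableOn (fun t => f (t + s)) (Ioi 0) ↔ IntegrableOn f (Ioi s) := by
  have h := (measurePreserving_add_right volume s).integrableOn_comp_preimage
    (measurableEmbedding_addRight s) (f := f) (s := Ioi s)
  simpa [Function.comp_def] using h

lemma setIntegral_Ioi_eq_add {f : ℝ → ℝ} {s : ℝ} (hs : 0 ≤ s) (hf : IntegrableOn f (Ioi 0)) :
    ∫ t in Ioi (0 : ℝ), f t = (∫ t in (0 : ℝ)..s, f t) + ∫ t in Ioi s, f t := by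
  rw [intervalIntegral.integral_of_le hs, ← setIntegral_union
    (Ioc_disjoint_Ioi le_rfl) measurableSet_Ioi (hf.mono_set Ioc_subset_Ioi_self)
    (hf.mono_set (Ioi_subset_Ioi hs)), Ioc_union_Ioi_eq_Ioi hs]

lemma integral_exp_neg_mul_Ioi {lam : ℝ} (hlam : 0 < lam) (C : ℝ) :
    ∫ t in Ioi (0 : ℝ), Real.exp (-lam * t) * C = C / lam := by
  rw [integral_mul_const, integral_exp_mul_Ioi (by linarith)]
  simp
  field_simp

end MeasureTheory

namespace WeakKAM

section Cost

variable {n : ℕ} {M : Type*} [MetricSpace M]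
    [ChartedSpace (EuclideanSpace ℝ (Fin n)) M]
    {H : (x : M) → CotangentSpace n x → ℝ}

/-- The cost `L(γ,γ') + c(H)` along a curve. -/
noncomputable def cost (H : (x : M) → CotangentSpace n x → ℝ) (γ : ℝ → M) (t : ℝ) : ℝ :=
  lagrangian H (γ t) (velocity n γ t) + criticalValue H

lemma cost_congr {γ γ' : ℝ → M} {t : ℝ} (h : γ =ᶠ[𝓝 t] γ') : cost H γ t = cost H γ' t := by
  unfold cost velocity
  rw [h.mfderiv_eq, h.self_of_nhds]

lemma cost_const (x : M) (t : ℝ) :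
    cost H (fun _ => x) t = lagrangian H x 0 + criticalValue H := by
  unfold cost velocity
  rw [mfderiv_const]
  rfl

/-- The curves over which the discounted action is minimized. -/
structure Admissible (H : (x : M) → CotangentSpace n x → ℝ) (lam : ℝ) (x : M) (γ : ℝ → M) :
    Prop where
  zero : γ 0 = x
  ac : ∀ T : ℝ, 0 ≤ T → AbsolutelyContinuousOnInterval γ 0 T
  integrable : IntegrableOn (fun t => Real.exp (-lam * t) * cost H γ t) (Ioi 0)

/-- The discounted action. -/
noncomputable def discountedAction (H : (x : M) → CotangentSpace n x → ℝ) (lam : ℝ)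
    (γ : ℝ → M) : ℝ :=
  ∫ t in Ioi (0 : ℝ), Real.exp (-lam * t) * cost H γ t

/-- The infimum of the discounted action. -/
noncomputable def discountedValue (H : (x : M) → CotangentSpace n x → ℝ) (lam : ℝ) (x : M) : ℝ :=
  sInf {r : ℝ | ∃ γ : ℝ → M, Admissible H lam x γ ∧ r = discountedAction H lam γ}

lemma forwardValue_eq (lam : ℝ) (x : M) : forwardValue H lam x = -discountedValue H lam x := by
  unfold forwardValue discountedValue
  congr 2
  ext r
  constructor
  · rintro ⟨γ, h0, h1, h2, h3⟩
    exact ⟨γ, ⟨h0, h1, h2⟩, h3⟩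
  · rintro ⟨γ, ⟨h0, h1, h2⟩, h3⟩
    exact ⟨γ, h0, h1, h2, h3⟩

lemma Admissible.continuousAt {lam t : ℝ} {x : M} {γ : ℝ → M} (h : Admissible H lam x γ)
    (ht : 0 < t) : ContinuousAt γ t :=
  (h.ac (t + 1) (by linarith)).continuousAt ⟨ht, by linarith⟩

lemma Admissible.ac_of_le {lam a b : ℝ} {x : M} {γ : ℝ → M} (h : Admissible H lam x γ)
    (ha : 0 ≤ a) (hab : a ≤ b) : AbsolutelyContinuousOnInterval γ a b :=
  (h.ac b (ha.trans hab)).mono (by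
    rw [uIcc_of_le hab, uIcc_of_le (ha.trans hab)]; exact Icc_subset_Icc_left ha)

lemma Admissible.intervalIntegrable_exp_mul {lam a b : ℝ} {x : M} {γ : ℝ → M}
    (h : Admissible H lam x γ) (ha : 0 ≤ a) (hab : a ≤ b) :
    IntervalIntegrable (fun t => Real.exp (-lam * t) * cost H γ t) volume a b :=
  (intervalIntegrable_iff_integrableOn_Ioc_of_le hab).2
    (h.integrable.mono_set fun _ ht => ha.trans_lt ht.1)

lemma Admissible.intervalIntegrable {lam a b : ℝ} {x : M} {γ : ℝ → M}
    (h : Admissible H lam x γ) (ha : 0 ≤ a) (hab : a ≤ b) :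
    IntervalIntegrable (cost H γ) volume a b := by
  have h1 := (h.intervalIntegrable_exp_mul ha hab).continuousOn_mul
    (g := fun t => Real.exp (lam * t)) (by fun_prop)
  refine h1.congr fun t _ => ?_
  simp only [← mul_assoc, ← Real.exp_add]
  simp

variable [IsManifold (𝓡 n) 1 M]

/-- The Lagrangian only depends on the coordinates of the velocity. -/
lemma lagrangian_congr {x y y' : M} (hyy' : y = y') (hy : y ∈ (extChartAt (𝓡 n) x).source)
    {v : TangentSpace (𝓡 n) y} {v' : TangentSpace (𝓡 n) y'}
    (hv : tangentCoord x y v = tangentCoord x y' v') :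
    lagrangian H y v = lagrangian H y' v' := by
  subst hyy'
  rw [lagrangian_eq_iSup_coord hy, lagrangian_eq_iSup_coord hy, hv]

/-- In coordinates the velocities are ordinary derivatives, which commute with translation even
where they take the default value. -/
lemma cost_comp_add_const {γ : ℝ → M} {t s : ℝ} (h : ContinuousAt γ (t + s)) :
    cost H (fun r => γ (r + s)) t = cost H γ (t + s) := by
  have hc : ContinuousAt (fun r => γ (r + s)) t :=
    ContinuousAt.comp (f := fun r => r + s) (g := γ) h (by fun_prop)
  unfold cost
  congr 1
  refine lagrangian_congr (x := γ (t + s)) rfl (mem_extChartAt_source _) ?_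
  rw [tangentCoord_velocity h (mem_extChartAt_source _)]
  rw [tangentCoord_velocity (γ := fun r => γ (r + s)) hc (mem_extChartAt_source _)]
  exact deriv_comp_add_const (extChartAt (𝓡 n) (γ (t + s)) ∘ γ) s t

lemma lagrangian_velocity_comp_neg {γ : ℝ → M} {t : ℝ} (h : ContinuousAt γ (-t)) :
    symmetric (lagrangian H) (γ (-t)) (velocity n (fun r => γ (-r)) t) =
      lagrangian H (γ (-t)) (velocity n γ (-t)) := by
  have hc : ContinuousAt (fun r => γ (-r)) t :=
    ContinuousAt.comp (f := fun r => -r) (g := γ) h (by fun_prop)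
  refine lagrangian_congr (x := γ (-t)) rfl (mem_extChartAt_source _) ?_
  rw [map_neg, tangentCoord_velocity h (mem_extChartAt_source _)]
  rw [tangentCoord_velocity (γ := fun r => γ (-r)) hc (mem_extChartAt_source _)]
  rw [neg_eq_iff_eq_neg]
  exact deriv_comp_neg (extChartAt (𝓡 n) (γ (-t)) ∘ γ) t

/-- Time reversal is a bijection between the two families of curves. It changes the sign of the
velocity, hence turns the symmetrical Lagrangian into L, and e^{λt} into e^{-λt}. -/
lemma symmetricBackwardValue_eq (lam : ℝ) (x : M) :
    symmetricBackwardValue H lam x = discountedValue H lam x := by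
  have hpt : ∀ γ : ℝ → M, ∀ t, ContinuousAt γ (-t) →
      symmetric (lagrangian H) (γ (-t)) (velocity n (fun r => γ (-r)) t) + criticalValue H =
        cost H γ (-t) := fun γ t h => by
    rw [lagrangian_velocity_comp_neg h]; rfl
  have hcont : ∀ γ : ℝ → M, (∀ T : ℝ, 0 ≤ T → AbsolutelyContinuousOnInterval γ 0 T) →
      ∀ t ∈ Iio (0 : ℝ), ContinuousAt γ (-t) := fun γ h t ht =>
    (h (-t + 1) (by linarith [mem_Iio.1 ht])).continuousAt ⟨by linarith [mem_Iio.1 ht], by linarith⟩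
  have hcong : ∀ γ : ℝ → M, (∀ T : ℝ, 0 ≤ T → AbsolutelyContinuousOnInterval γ 0 T) →
      EqOn (fun t => Real.exp (lam * t) * (symmetric (lagrangian H) (γ (-t))
        (velocity n (fun r => γ (-r)) t) + criticalValue H))
        (fun t => (fun s => Real.exp (-lam * s) * cost H γ s) (-t)) (Iio 0) := by
    intro γ h t ht
    simp only [hpt γ t (hcont γ h t ht), neg_mul_neg]
  have hI : ∀ γ : ℝ → M, (∀ T : ℝ, 0 ≤ T → AbsolutelyContinuousOnInterval γ 0 T) →
      ∫ t in Iio (0 : ℝ), Real.exp (lam * t) * (symmetric (lagrangian H) (γ (-t))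
        (velocity n (fun r => γ (-r)) t) + criticalValue H) = discountedAction H lam γ := by
    intro γ h
    rw [setIntegral_congr_fun measurableSet_Iio (hcong γ h), ← integral_Iic_eq_integral_Iio,
      integral_comp_neg_Iic 0 (fun s => Real.exp (-lam * s) * cost H γ s), neg_zero,
      discountedAction]
  unfold symmetricBackwardValue discountedValue
  congr 1
  ext r
  constructor
  · rintro ⟨γ', h0, h1, h2, h3⟩
    obtain ⟨γ, rfl⟩ : ∃ γ : ℝ → M, γ' = fun t => γ (-t) := ⟨fun t => γ' (-t), by simp⟩
    have hac : ∀ T : ℝ, 0 ≤ T → AbsolutelyContinuousOnInterval γ 0 T := fun T hT => by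
      have := (AbsolutelyContinuousOnInterval.comp_neg (f := fun t => γ (-t)) (a := 0) (b := T)
        (by simpa using (h1 T hT).symm))
      simpa using this
    refine ⟨γ, ⟨by simpa using h0, hac, ?_⟩, h3.trans (hI γ hac)⟩
    have h2' : IntegrableOn (fun t => (fun s => Real.exp (-lam * s) * cost H γ s) (-t))
      (Iio (-0)) := by
      rw [neg_zero]
      exact h2.congr_fun (hcong γ hac) measurableSet_Iio
    have h4 : IntegrableOn (fun t => (fun s => Real.exp (-lam * s) * cost H γ s) (- -t)) (Ioi 0) :=
      h2'.comp_neg_Ioi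
    simp only [neg_neg] at h4
    exact h4
  · rintro ⟨γ, ⟨h0, h1, h2⟩, h3⟩
    refine ⟨fun t => γ (-t), by simpa using h0, fun T hT => ?_, ?_, h3.trans (hI γ h1).symm⟩
    · exact AbsolutelyContinuousOnInterval.comp_neg (by simpa using (h1 T hT).symm)
    · rw [integrableOn_congr_fun (hcong γ h1) measurableSet_Iio]
      have h2' : IntegrableOn (fun t => Real.exp (-lam * t) * cost H γ t) (Ioi (-0)) := by
        simpa using h2
      exact h2'.comp_neg_Iio

lemma Admissible.shift {lam s : ℝ} {x : M} {γ : ℝ → M} (h : Admissible H lam x γ) (hs : 0 ≤ s) :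
    Admissible H lam (γ s) (fun t => γ (t + s)) ∧
      ∫ t in Ioi s, Real.exp (-lam * t) * cost H γ t =
        Real.exp (-lam * s) * discountedAction H lam (fun t => γ (t + s)) := by
  have hc : EqOn (fun t => Real.exp (-lam * (t + s)) * cost H γ (t + s))
      (fun t => Real.exp (-lam * s) *
        (Real.exp (-lam * t) * cost H (fun t => γ (t + s)) t)) (Ioi 0) := by
    intro t ht
    simp only
    rw [cost_comp_add_const (h.continuousAt (add_pos_of_pos_of_nonneg ht hs)), ← mul_assoc,
      ← Real.exp_add]
    ring_nf
  refine ⟨⟨by simp, fun T hT => ?_, ?_⟩, ?_⟩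
  · exact AbsolutelyContinuousOnInterval.comp_add_const s
      (by rw [zero_add]; exact h.ac_of_le hs (by linarith))
  · have h1 := integrableOn_Ioi_comp_add_right_iff.2 (h.integrable.mono_set (Ioi_subset_Ioi hs))
    rw [integrableOn_congr_fun hc measurableSet_Ioi] at h1
    have h2 : IntegrableOn _ _ _ := h1.const_mul (Real.exp (lam * s))
    refine h2.congr_fun (fun t _ => ?_) measurableSet_Ioi
    simp only [← mul_assoc, ← Real.exp_add]
    simp
  · rw [← setIntegral_Ioi_comp_add_right, setIntegral_congr_fun measurableSet_Ioi hc,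
      integral_const_mul, discountedAction]

/-- Following a curve on `[0,T]` and then an admissible curve. -/
lemma Admissible.glue {lam T : ℝ} (hT : 0 ≤ T) {σ γ : ℝ → M} (h : Admissible H lam (σ T) γ)
    (hσ : AbsolutelyContinuousOnInterval σ 0 T)
    (hint : IntervalIntegrable (cost H σ) volume 0 T) :
    ∃ ρ : ℝ → M, Admissible H lam (σ 0) ρ ∧ discountedAction H lam ρ =
      (∫ t in (0 : ℝ)..T, Real.exp (-lam * t) * cost H σ t) +
        Real.exp (-lam * T) * discountedAction H lam γ := by
  set ρ : ℝ → M := fun t => if t ≤ T then σ t else γ (t - T) with hρ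
  have hleft : EqOn σ ρ (Iic T) := fun t ht => by simp [hρ, mem_Iic.1 ht]
  have hright : EqOn (fun t => γ (t - T)) ρ (Ici T) := fun t ht => by
    rcases (mem_Ici.1 ht).eq_or_lt with rfl | h1
    · simp [hρ, h.zero]
    · simp [hρ, h1.not_ge]
  have hρac : ∀ S, T ≤ S → AbsolutelyContinuousOnInterval ρ 0 S := by
    intro S hS
    refine AbsolutelyContinuousOnInterval.glue hT hS (hσ.congr (hleft.mono ?_))
      (AbsolutelyContinuousOnInterval.congr (f := fun t => γ (t - T)) ?_ (hright.mono ?_))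
    · rw [uIcc_of_le hT]; exact Icc_subset_Iic_self
    · simp only [sub_eq_add_neg]
      exact AbsolutelyContinuousOnInterval.comp_add_const (-T)
        (by simpa using h.ac (S + -T) (by linarith))
    · rw [uIcc_of_le hS]; exact Icc_subset_Ici_self
  -- Costs are compared only off the junction time T: there the velocity of ρ may agree with neither
  -- piece, but one instant has measure zero.
  have hcl : EqOn (fun t => Real.exp (-lam * t) * cost H σ t)
      (fun t => Real.exp (-lam * t) * cost H ρ t) (Iio T) := fun t ht => by
    simp only
    rw [cost_congr (hleft.eventuallyEq_of_mem (Iic_mem_nhds ht))]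
  have hcr : EqOn (fun t => Real.exp (-lam * T) * (Real.exp (-lam * t) * cost H γ t))
      (fun t => Real.exp (-lam * (t + T)) * cost H ρ (t + T)) (Ioi 0) := fun t ht => by
    have h1 : cost H ρ (t + T) = cost H (fun r => γ (r - T)) (t + T) :=
      (cost_congr (hright.eventuallyEq_of_mem (Ici_mem_nhds (by linarith [mem_Ioi.1 ht])))).symm
    have h2 := cost_comp_add_const (H := H) (γ := γ) (t := t + T) (s := -T)
      (by simpa using h.continuousAt ht)
    simp only [← sub_eq_add_neg] at h2
    simp only
    rw [h1, h2, ← mul_assoc, ← Real.exp_add]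
    ring_nf
  have hint1 : IntegrableOn (fun t => Real.exp (-lam * t) * cost H ρ t) (Ioc 0 T) := by
    rw [integrableOn_Ioc_iff_integrableOn_Ioo]
    refine IntegrableOn.congr_fun (f := fun t => Real.exp (-lam * t) * cost H σ t) ?_
      (hcl.mono Ioo_subset_Iio_self) measurableSet_Ioo
    rw [← intervalIntegrable_iff_integrableOn_Ioo_of_le hT]
    exact hint.continuousOn_mul (by fun_prop)
  have hint2 : IntegrableOn (fun t => Real.exp (-lam * t) * cost H ρ t) (Ioi T) := by
    rw [← integrableOn_Ioi_comp_add_right_iff]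
    exact IntegrableOn.congr_fun (h.integrable.const_mul _) hcr measurableSet_Ioi
  have hint3 : IntegrableOn (fun t => Real.exp (-lam * t) * cost H ρ t) (Ioi 0) := by
    rw [← Ioc_union_Ioi_eq_Ioi hT]
    exact hint1.union hint2
  refine ⟨ρ, ⟨(hleft hT).symm, fun S hS => ?_, hint3⟩, ?_⟩
  · refine (hρac (max S T) (le_max_right _ _)).mono ?_
    rw [uIcc_of_le hS, uIcc_of_le (hS.trans (le_max_left _ _))]
    exact Icc_subset_Icc_right (le_max_left _ _)
  · rw [discountedAction, setIntegral_Ioi_eq_add hT hint3]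
    congr 1
    · rw [intervalIntegral.integral_of_le hT, intervalIntegral.integral_of_le hT,
        integral_Ioc_eq_integral_Ioo, integral_Ioc_eq_integral_Ioo]
      exact (setIntegral_congr_fun measurableSet_Ioo (hcl.mono Ioo_subset_Iio_self)).symm
    · rw [← setIntegral_Ioi_comp_add_right, ← setIntegral_congr_fun measurableSet_Ioi hcr,
        integral_const_mul, discountedAction]

end Cost
end WeakKAM

/-- The hypothesis says that t ↦ ∫ g - f is monotone, so its derivative, which is g - f' almost
everywhere by Lebesgue differentiation, is nonnegative. -/
lemma AbsolutelyContinuousOnInterval.ae_deriv_le {f g : ℝ → ℝ} {a b : ℝ} (hab : a ≤ b)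
    (hf : AbsolutelyContinuousOnInterval f a b) (hg : IntervalIntegrable g volume a b)
    (h : ∀ s ∈ Icc a b, ∀ t ∈ Icc a b, s ≤ t → f t - f s ≤ ∫ r in s..t, g r) :
    ∀ᵐ t, t ∈ Ioo a b → deriv f t ≤ g t := by
  have hsub : ∀ {s t}, s ∈ Icc a b → t ∈ Icc a b → IntervalIntegrable g volume s t :=
    fun hs ht => hg.mono_set (by
      rw [uIcc_of_le hab]; exact (convex_Icc a b).ordConnected.uIcc_subset hs ht)
  have hmono : MonotoneOn (fun t => (∫ r in a..t, g r) - f t) (Icc a b) := by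
    intro s hs t ht hst
    have h1 := h s hs t ht hst
    have h2 := intervalIntegral.integral_add_adjacent_intervals
      (hsub (left_mem_Icc.2 hab) hs) (hsub hs ht)
    simp only
    linarith
  filter_upwards [hf.ae_differentiableAt, hg.ae_hasDerivAt_integral] with t h1 h2 ht
  have htI : t ∈ uIcc a b := by rw [uIcc_of_le hab]; exact Ioo_subset_Icc_self ht
  have hd := (h2 htI a left_mem_uIcc).sub (h1 htI).hasDerivAt
  have h3 := hmono.derivWithin_nonneg (x := t)
  rw [derivWithin_of_mem_nhds (Icc_mem_nhds ht.1 ht.2)] at h3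
  have h4 : deriv (fun t => (∫ r in a..t, g r) - f t) t = g t - deriv f t := hd.deriv
  linarith

/-- Integration by parts for discounted integrals. -/
lemma discounted_integral_le {f a : ℝ → ℝ} {lam D : ℝ} (hlam : 0 < lam)
    (hf : ∀ T, 0 ≤ T → AbsolutelyContinuousOnInterval f 0 T) (hD : ∀ t, |f t| ≤ D)
    (ha : IntegrableOn (fun t => Real.exp (-lam * t) * a t) (Ioi 0))
    (hfa : ∀ T, 0 ≤ T → ∀ᵐ t, t ∈ Ioo 0 T → deriv f t ≤ a t) :
    IntegrableOn (fun t => Real.exp (-lam * t) * f t) (Ioi 0) ∧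
    lam * (∫ t in Ioi (0 : ℝ), Real.exp (-lam * t) * f t) - f 0 ≤
      ∫ t in Ioi (0 : ℝ), Real.exp (-lam * t) * a t := by
  have hcont : ContinuousOn f (Ioi 0) := fun t ht =>
    ((hf (t + 1) (by linarith [mem_Ioi.1 ht])).continuousAt
      ⟨ht, by linarith⟩).continuousWithinAt
  have hint : IntegrableOn (fun t => Real.exp (-lam * t) * f t) (Ioi 0) := by
    refine Integrable.mono' ((exp_neg_integrableOn_Ioi 0 hlam).mul_const D)
      (ContinuousOn.aestronglyMeasurable (by fun_prop) measurableSet_Ioi)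
      (Eventually.of_forall fun t => ?_)
    rw [norm_mul, Real.norm_of_nonneg (Real.exp_pos _).le, Real.norm_eq_abs]
    gcongr
    exact hD t
  refine ⟨hint, ?_⟩
  -- Integrate (e^{-λt} f)' ≤ e^{-λt} a - λ e^{-λt} f over [0,T]; the boundary term at T will vanish
  -- because f is bounded.
  have hle : ∀ T : ℝ, 0 ≤ T → Real.exp (-lam * T) * f T - f 0 ≤
      (∫ t in (0 : ℝ)..T, Real.exp (-lam * t) * a t) -
        lam * ∫ t in (0 : ℝ)..T, Real.exp (-lam * t) * f t := by
    intro T hT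
    have hfT := hf T hT
    have hexp : AbsolutelyContinuousOnInterval (fun t => Real.exp (-lam * t)) 0 T :=
      ContDiffOn.absolutelyContinuousOnInterval (by fun_prop)
    have i1 : IntervalIntegrable (fun t => Real.exp (-lam * t) * a t) volume 0 T :=
      (intervalIntegrable_iff_integrableOn_Ioc_of_le hT).2 (ha.mono_set Ioc_subset_Ioi_self)
    have i2 : IntervalIntegrable (fun t => Real.exp (-lam * t) * f t) volume 0 T :=
      (intervalIntegrable_iff_integrableOn_Ioc_of_le hT).2 (hint.mono_set Ioc_subset_Ioi_self)
    have h1 := (hexp.fun_mul hfT).sub_le_integral hT (i1.sub (i2.const_mul lam)) (by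
      filter_upwards [hfT.ae_differentiableAt, hfa T hT] with t h1 h2 ht
      have hd := (h1 (by rw [uIcc_of_le hT]; exact Ioo_subset_Icc_self ht)).hasDerivAt
      have he : HasDerivAt (fun t => Real.exp (-lam * t)) (Real.exp (-lam * t) * (-lam)) t := by
        simpa using ((hasDerivAt_id t).const_mul (-lam)).exp
      rw [(he.fun_mul hd).deriv]
      have := mul_le_mul_of_nonneg_left (h2 ht) (Real.exp_pos (-lam * t)).le
      linarith)
    rw [intervalIntegral.integral_sub i1 (i2.const_mul lam),
      intervalIntegral.integral_const_mul] at h1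
    simpa using h1
  have hlim0 : Tendsto (fun T => Real.exp (-lam * T) * f T) atTop (𝓝 0) := by
    have hexp : Tendsto (fun T : ℝ => Real.exp (-lam * T)) atTop (𝓝 0) :=
      Real.tendsto_exp_atBot.comp (tendsto_id.const_mul_atTop_of_neg (by linarith))
    exact hexp.zero_mul_isBoundedUnder_le
      (isBoundedUnder_of ⟨D, fun t => by simpa using hD t⟩)
  have l1 := hlim0.sub_const (f 0)
  have l2 := (intervalIntegral_tendsto_integral_Ioi 0 ha tendsto_id).sub
    ((intervalIntegral_tendsto_integral_Ioi 0 hint tendsto_id).const_mul lam)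
  have := le_of_tendsto_of_tendsto l1 l2 (by
    filter_upwards [eventually_ge_atTop 0] with T hT using hle T hT)
  linarith

/-! ### The discounted value: dynamic programming, Lipschitz bounds, subsolutions. -/

namespace WeakKAM

section Value

variable {n : ℕ} {M : Type*} [MetricSpace M] [CompactSpace M]
    [ChartedSpace (EuclideanSpace ℝ (Fin n)) M] [IsManifold (𝓡 n) 1 M]
    {H : (x : M) → CotangentSpace n x → ℝ}

lemma ConvexSuperlinear.exists_cost_bounds (hH : ConvexSuperlinear H) :
    ∃ C : ℝ, 0 ≤ C ∧ (∀ (γ : ℝ → M) t, -C ≤ cost H γ t) ∧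
      ∀ (x : M) t, cost H (fun _ => x) t ≤ C := by
  obtain ⟨B, hB⟩ := hH.exists_le_lagrangian
  obtain ⟨B', hB'⟩ := hH.exists_lagrangian_zero_le
  refine ⟨|B| + |B'| + |criticalValue H|, by positivity, fun γ t => ?_, fun x t => ?_⟩
  · have := hB (γ t) (velocity n γ t)
    unfold cost
    linarith [le_abs_self B, abs_nonneg B', neg_abs_le (criticalValue H)]
  · rw [cost_const]
    linarith [hB' x, le_abs_self B', abs_nonneg B, le_abs_self (criticalValue H)]

omit [CompactSpace M] [IsManifold (𝓡 n) 1 M] in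
lemma admissible_const {lam : ℝ} (hlam : 0 < lam) (x : M) : Admissible H lam x (fun _ => x) := by
  refine ⟨rfl, fun T _ => ?_, ?_⟩
  · exact AbsolutelyContinuousOnInterval.of_dist_le_mul (f := fun t : ℝ => t) (C := 0)
      LipschitzWith.id.lipschitzOnWith.absolutelyContinuousOnInterval (by simp)
  · simp only [cost_const]
    exact (exp_neg_integrableOn_Ioi 0 hlam).mul_const _

omit [CompactSpace M] [IsManifold (𝓡 n) 1 M] in
lemma Admissible.neg_div_le {lam C : ℝ} (hlam : 0 < lam) {x : M} {γ : ℝ → M}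
    (h : Admissible H lam x γ) (hC : ∀ t, -C ≤ cost H γ t) :
    -(C / lam) ≤ discountedAction H lam γ := by
  rw [← neg_div, ← integral_exp_neg_mul_Ioi hlam]
  refine setIntegral_mono ((exp_neg_integrableOn_Ioi 0 hlam).mul_const _) h.integrable fun t => ?_
  have := hC t
  simp only
  gcongr

lemma Admissible.value_le (hH : ConvexSuperlinear H) {lam : ℝ} (hlam : 0 < lam) {x : M}
    {γ : ℝ → M} (h : Admissible H lam x γ) :
    discountedValue H lam x ≤ discountedAction H lam γ := by
  obtain ⟨C, -, hC, -⟩ := hH.exists_cost_bounds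
  refine csInf_le ⟨-(C / lam), ?_⟩ ⟨γ, h, rfl⟩
  rintro _ ⟨γ, hγ, rfl⟩
  exact hγ.neg_div_le hlam (hC γ)

omit [CompactSpace M] [IsManifold (𝓡 n) 1 M] in
lemma le_discountedValue {lam : ℝ} (hlam : 0 < lam) {x : M} {B : ℝ}
    (h : ∀ γ, Admissible H lam x γ → B ≤ discountedAction H lam γ) :
    B ≤ discountedValue H lam x := by
  refine le_csInf ⟨_, _, admissible_const hlam x, rfl⟩ ?_
  rintro _ ⟨γ, hγ, rfl⟩
  exact h γ hγ

omit [CompactSpace M] [IsManifold (𝓡 n) 1 M] in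
lemma exists_discountedAction_lt {lam : ℝ} (hlam : 0 < lam) (x : M) {ε : ℝ} (hε : 0 < ε) :
    ∃ γ, Admissible H lam x γ ∧ discountedAction H lam γ < discountedValue H lam x + ε := by
  obtain ⟨_, ⟨γ, hγ, rfl⟩, h⟩ := exists_lt_of_csInf_lt
    (s := {r : ℝ | ∃ γ : ℝ → M, Admissible H lam x γ ∧ r = discountedAction H lam γ})
    ⟨_, _, admissible_const hlam x, rfl⟩ (lt_add_of_pos_right _ hε)
  exact ⟨γ, hγ, h⟩

/-- The lower bound on L and the cost of constant curves give |V_λ| ≤ C/λ. This crude bound is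
enough to control the discount term in the Lipschitz estimate. -/
lemma ConvexSuperlinear.exists_mul_value_le (hH : ConvexSuperlinear H) :
    ∃ C : ℝ, 0 ≤ C ∧ ∀ lam : ℝ, 0 < lam → ∀ x : M, |lam * discountedValue H lam x| ≤ C := by
  obtain ⟨C, hC0, hC, hC'⟩ := hH.exists_cost_bounds
  refine ⟨C, hC0, fun lam hlam x => ?_⟩
  have h1 : -(C / lam) ≤ discountedValue H lam x :=
    le_discountedValue hlam fun γ hγ => hγ.neg_div_le hlam (hC γ)
  have h2 : discountedValue H lam x ≤ C / lam := by
    refine ((admissible_const hlam x).value_le hH hlam).trans ?_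
    rw [← integral_exp_neg_mul_Ioi hlam]
    refine setIntegral_mono (admissible_const hlam x).integrable
      ((exp_neg_integrableOn_Ioi 0 hlam).mul_const _) fun t => ?_
    have := hC' x t
    simp only
    gcongr
  rw [abs_le]
  constructor
  · rw [← neg_div, div_le_iff₀ hlam] at h1
    linarith
  · rw [le_div_iff₀ hlam] at h2
    linarith

/-- The dynamic programming inequality. -/
lemma ConvexSuperlinear.value_le_integral_add (hH : ConvexSuperlinear H) {lam : ℝ}
    (hlam : 0 < lam) {T : ℝ} (hT : 0 ≤ T) {σ : ℝ → M}
    (hσ : AbsolutelyContinuousOnInterval σ 0 T)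
    (hint : IntervalIntegrable (cost H σ) volume 0 T) :
    discountedValue H lam (σ 0) ≤ (∫ t in (0 : ℝ)..T, Real.exp (-lam * t) * cost H σ t) +
      Real.exp (-lam * T) * discountedValue H lam (σ T) := by
  refine le_of_forall_pos_le_add fun ε hε => ?_
  obtain ⟨γ, hγ, hJ⟩ := exists_discountedAction_lt (H := H) hlam (σ T) hε
  obtain ⟨ρ, hρ, hJρ⟩ := hγ.glue hT hσ hint
  have h1 := hρ.value_le hH hlam
  have h2 : Real.exp (-lam * T) * discountedAction H lam γ ≤
      Real.exp (-lam * T) * discountedValue H lam (σ T) + ε := by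
    have h3 : Real.exp (-lam * T) ≤ 1 := Real.exp_le_one_iff.2 (by nlinarith)
    have h4 : Real.exp (-lam * T) * discountedAction H lam γ ≤
      Real.exp (-lam * T) * (discountedValue H lam (σ T) + ε) := by gcongr
    nlinarith [Real.exp_pos (-lam * T)]
  linarith

lemma ConvexSuperlinear.exp_mul_value_le (hH : ConvexSuperlinear H) {lam : ℝ}
    (hlam : 0 < lam) {a b : ℝ} (hab : a ≤ b) {σ : ℝ → M}
    (hσ : AbsolutelyContinuousOnInterval σ a b)
    (hint : IntervalIntegrable (cost H σ) volume a b) :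
    Real.exp (-lam * a) * discountedValue H lam (σ a) ≤
      (∫ t in a..b, Real.exp (-lam * t) * cost H σ t) +
        Real.exp (-lam * b) * discountedValue H lam (σ b) := by
  have hc : EqOn (fun t => cost H σ (t + a)) (cost H (fun t => σ (t + a))) (Ioo 0 (b - a)) :=
    fun t ht => (cost_comp_add_const (hσ.continuousAt
      ⟨by linarith [ht.1], by linarith [ht.2]⟩)).symm
  have hba : 0 ≤ b - a := by linarith
  have h1 := hH.value_le_integral_add hlam hba (σ := fun t => σ (t + a))
    (AbsolutelyContinuousOnInterval.comp_add_const a (by simpa using hσ)) (by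
      have := hint.comp_add_right a
      rw [sub_self] at this
      rw [intervalIntegrable_iff_integrableOn_Ioo_of_le hba] at this ⊢
      exact this.congr_fun hc measurableSet_Ioo)
  have h2 : ∫ t in (0 : ℝ)..(b - a), Real.exp (-lam * t) * cost H (fun t => σ (t + a)) t =
      Real.exp (lam * a) * ∫ t in a..b, Real.exp (-lam * t) * cost H σ t := by
    have h3 := intervalIntegral.integral_comp_add_right (a := 0) (b := b - a)
      (fun t => Real.exp (lam * a) * (Real.exp (-lam * t) * cost H σ t)) a
    rw [zero_add, sub_add_cancel] at h3
    rw [← intervalIntegral.integral_const_mul, ← h3, intervalIntegral.integral_of_le hba,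
      intervalIntegral.integral_of_le hba,
      integral_Ioc_eq_integral_Ioo, integral_Ioc_eq_integral_Ioo]
    refine setIntegral_congr_fun measurableSet_Ioo fun t ht => ?_
    rw [show cost H (fun t => σ (t + a)) t = cost H σ (t + a) from (hc ht).symm, ← mul_assoc,
      ← Real.exp_add]
    ring_nf
  rw [h2] at h1
  simp only [zero_add, sub_add_cancel] at h1
  have h3 := mul_le_mul_of_nonneg_left h1 (Real.exp_pos (-lam * a)).le
  refine h3.trans_eq ?_
  rw [mul_add, ← mul_assoc, ← mul_assoc, ← Real.exp_add, ← Real.exp_add]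
  ring_nf
  simp

/-- Along a nearly optimal curve the cost is nearly the decrease of the discounted value. -/
lemma Admissible.integral_le (hH : ConvexSuperlinear H) {lam : ℝ} (hlam : 0 < lam) {x : M}
    {γ : ℝ → M} (h : Admissible H lam x γ) {ε : ℝ}
    (hε : discountedAction H lam γ ≤ discountedValue H lam x + ε) {s t : ℝ} (hs : 0 ≤ s)
    (hst : s ≤ t) :
    ∫ r in s..t, Real.exp (-lam * r) * cost H γ r ≤
      Real.exp (-lam * s) * discountedValue H lam (γ s) -
        Real.exp (-lam * t) * discountedValue H lam (γ t) + ε := by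
  -- The action is split at s and t. Dynamic programming bounds the first piece below by V_λ(x) -
  -- e^{-λs}V_λ(γ s), and the tail costs at least e^{-λt}V_λ(γ t); near-optimality bounds what
  -- remains.
  have h1 := hH.exp_mul_value_le hlam hs (h.ac s hs) (h.intervalIntegrable le_rfl hs)
  have h2 := setIntegral_Ioi_eq_add (hs.trans hst) h.integrable
  have h3 := intervalIntegral.integral_add_adjacent_intervals
    (h.intervalIntegrable_exp_mul le_rfl hs) (h.intervalIntegrable_exp_mul hs hst)
  obtain ⟨h4, h5⟩ := h.shift (hs.trans hst)
  have h6 := mul_le_mul_of_nonneg_left (h4.value_le hH hlam) (Real.exp_pos (-lam * t)).le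
  rw [h.zero, mul_zero, Real.exp_zero, one_mul] at h1
  rw [discountedAction] at hε
  linarith

variable [ConnectedSpace M]

/-- Reach z from y in a time T = O(dist y z) with bounded Lagrangian, then continue nearly optimally
from z. The delay costs at most |e^{-λT} - 1||V_λ| ≤ T * |λV_λ|, which is bounded by T * C uniformly
in λ. -/
lemma ConvexSuperlinear.exists_lipschitz_value (hH : ConvexSuperlinear H)
    (hM : BilipschitzCharts n M) : ∃ B : ℝ, ∀ lam : ℝ, 0 < lam → ∀ x y : M,
      |discountedValue H lam x - discountedValue H lam y| ≤ B * dist x y := by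
  obtain ⟨δ, hδ, C₁, C₂, hcurve⟩ := hH.exists_short_curve hM
  obtain ⟨C, hC0, hC⟩ := hH.exists_mul_value_le
  set A := |C₁ + criticalValue H| + C with hA
  obtain ⟨B, hB⟩ := exists_forall_abs_sub_le_mul_dist (M := M) hδ (A * C₂)
  refine ⟨B, fun lam hlam => hB _ ?_⟩
  have key : ∀ y z : M, dist y z < δ →
      discountedValue H lam y - discountedValue H lam z ≤ A * C₂ * dist y z := by
    intro y z hyz
    obtain ⟨T, hT0, hT, σ, rfl, rfl, hAC, hσ⟩ := hcurve y z hyz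
    have hint : IntervalIntegrable (cost H σ) volume 0 T :=
      (hH.intervalIntegrable_of_le hT0 hAC hσ).add intervalIntegrable_const
    have h1 := hH.value_le_integral_add hlam hT0 hAC hint
    have h2 : ∫ t in (0 : ℝ)..T, Real.exp (-lam * t) * cost H σ t ≤
        ∫ _ in (0 : ℝ)..T, |C₁ + criticalValue H| := by
      refine intervalIntegral.integral_mono_on_of_le_Ioo hT0
        (hint.continuousOn_mul (by fun_prop)) intervalIntegrable_const fun t ht => ?_
      have h3 : cost H σ t ≤ |C₁ + criticalValue H| := by
        unfold cost
        linarith [hσ t ht, le_abs_self (C₁ + criticalValue H)]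
      have h4 : Real.exp (-lam * t) ≤ 1 := Real.exp_le_one_iff.2 (by nlinarith [ht.1])
      calc Real.exp (-lam * t) * cost H σ t ≤ Real.exp (-lam * t) * |C₁ + criticalValue H| := by
            gcongr
        _ ≤ 1 * |C₁ + criticalValue H| := by gcongr
        _ = _ := one_mul _
    rw [intervalIntegral.integral_const, sub_zero, smul_eq_mul] at h2
    have h5 : (Real.exp (-lam * T) - 1) * discountedValue H lam (σ T) ≤ T * C := by
      have h6 : |Real.exp (-lam * T) - 1| ≤ lam * T := by
        rw [abs_le]
        constructor
        · linarith [Real.add_one_le_exp (-lam * T)]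
        · have : Real.exp (-lam * T) ≤ 1 := Real.exp_le_one_iff.2 (by nlinarith)
          nlinarith
      calc (Real.exp (-lam * T) - 1) * discountedValue H lam (σ T)
          ≤ |Real.exp (-lam * T) - 1| * |discountedValue H lam (σ T)| := by
            rw [← abs_mul]; exact le_abs_self _
        _ ≤ (lam * T) * |discountedValue H lam (σ T)| := by gcongr
        _ = T * |lam * discountedValue H lam (σ T)| := by
          rw [abs_mul, abs_of_pos hlam]; ring
        _ ≤ T * C := by gcongr; exact hC lam hlam _
    have h7 : T * A ≤ (C₂ * dist (σ 0) (σ T)) * A := by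
      have : 0 ≤ A := by positivity
      gcongr
    rw [hA] at h7 ⊢
    linarith
  intro y z hyz
  rw [abs_le]
  have h1 := key y z hyz
  have h2 := key z y (by rwa [dist_comm])
  rw [dist_comm] at h2
  constructor <;> linarith

omit [CompactSpace M] [IsManifold (𝓡 n) 1 M] [ConnectedSpace M]
  [ChartedSpace (EuclideanSpace ℝ (Fin n)) M] in
lemma ac_comp_of_lipschitz {σ : ℝ → M} {a b B : ℝ} {f : M → ℝ}
    (hσ : AbsolutelyContinuousOnInterval σ a b) (hf : ∀ x y, |f x - f y| ≤ B * dist x y) :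
    AbsolutelyContinuousOnInterval (fun t => f (σ t)) a b :=
  hσ.of_dist_le_mul fun s _ t _ => by rw [Real.dist_eq]; exact hf _ _

/-- This is dynamic programming in infinitesimal form: differentiate the increment bound for
-e^{-λt}V_λ(σ t) and cancel the exponential. -/
lemma ConvexSuperlinear.ae_deriv_value_ge (hH : ConvexSuperlinear H)
    (hM : BilipschitzCharts n M) {lam : ℝ} (hlam : 0 < lam) {σ : ℝ → M} {a b : ℝ} (hab : a ≤ b)
    (hσ : AbsolutelyContinuousOnInterval σ a b)
    (hint : IntervalIntegrable (cost H σ) volume a b) :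
    ∀ᵐ t, t ∈ Ioo a b → deriv (fun t => -discountedValue H lam (σ t)) t ≤
      cost H σ t - lam * discountedValue H lam (σ t) := by
  obtain ⟨B, hB⟩ := hH.exists_lipschitz_value hM
  have hV := ac_comp_of_lipschitz hσ (hB lam hlam)
  have hexp : AbsolutelyContinuousOnInterval (fun t => Real.exp (-lam * t)) a b :=
    ContDiffOn.absolutelyContinuousOnInterval (by fun_prop)
  have h1 := (hexp.fun_mul hV.fun_neg).ae_deriv_le hab
    (hint.continuousOn_mul (g := fun t => Real.exp (-lam * t)) (by fun_prop))
    fun s hs t ht hst => by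
      have hsub : uIcc s t ⊆ uIcc a b := by
        rw [uIcc_of_le hab]; exact (convex_Icc a b).ordConnected.uIcc_subset hs ht
      have := hH.exp_mul_value_le hlam hst (hσ.mono hsub) (hint.mono_set hsub)
      linarith
  filter_upwards [h1, hV.ae_differentiableAt] with t h1 h2 ht
  have hd := (h2 (by rw [uIcc_of_le hab]; exact Ioo_subset_Icc_self ht)).hasDerivAt
  have he : HasDerivAt (fun t => Real.exp (-lam * t)) (Real.exp (-lam * t) * (-lam)) t := by
    simpa using ((hasDerivAt_id t).const_mul (-lam)).exp
  have h3 := h1 ht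
  rw [(he.fun_mul hd.fun_neg).deriv] at h3
  rw [hd.fun_neg.deriv]
  refine le_of_mul_le_mul_left ?_ (Real.exp_pos (-lam * t))
  linarith

/-- Replacing λV_λ by its lower bound λm turns the discounted inequality into an undiscounted one,
which can be compared with the critical value. -/
lemma ConvexSuperlinear.dominated_neg_value (hH : ConvexSuperlinear H)
    (hM : BilipschitzCharts n M) {lam : ℝ} (hlam : 0 < lam) {m : ℝ}
    (hm : ∀ x : M, m ≤ discountedValue H lam x) :
    Dominated (lagrangian H) (criticalValue H - lam * m) (fun x => -discountedValue H lam x) := by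
  intro a b γ hab hγ hint
  obtain ⟨B, hB⟩ := hH.exists_lipschitz_value hM
  have hV := ac_comp_of_lipschitz hγ (hB lam hlam)
  refine hV.fun_neg.sub_le_integral hab hint ?_
  have hint' : IntervalIntegrable (cost H γ) volume a b := by
    have := hint.add (intervalIntegrable_const (c := lam * m))
    refine this.congr fun t _ => ?_
    simp only [cost]
    ring
  filter_upwards [hH.ae_deriv_value_ge hM hlam hab hγ hint'] with t h ht
  have h1 := h ht
  have h2 := mul_le_mul_of_nonneg_left (hm (γ t)) hlam.le
  unfold cost at h1
  linarith

-- A constant curve at x forces c ≥ -L(x,0). With `nonempty_dominated`, this makes `criticalValue` a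
-- true infimum instead of a default value.
omit [ConnectedSpace M] in
lemma ConvexSuperlinear.bddBelow_dominated [Nonempty M] (hH : ConvexSuperlinear H) :
    BddBelow {c : ℝ | ∃ w : M → ℝ, Continuous w ∧ Dominated (lagrangian H) c w} := by
  obtain ⟨B, hB⟩ := hH.exists_lagrangian_zero_le
  obtain ⟨x⟩ := ‹Nonempty M›
  refine ⟨-B, ?_⟩
  rintro c ⟨w, -, hw⟩
  have hv : ∀ t, lagrangian H x (velocity n (fun _ => x) t) + c = lagrangian H x 0 + c := by
    intro t
    unfold velocity
    rw [mfderiv_const]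
    rfl
  have h1 := hw 0 1 (fun _ => x) zero_le_one ((admissible_const (H := H) one_pos x).ac 1 zero_le_one)
    (by simp only [hv]; exact intervalIntegrable_const)
  simp only [hv, sub_self, intervalIntegral.integral_const, sub_zero, one_smul] at h1
  linarith [hB x]

omit [ConnectedSpace M] in
lemma ConvexSuperlinear.nonempty_dominated (hH : ConvexSuperlinear H) :
    {c : ℝ | ∃ w : M → ℝ, Continuous w ∧ Dominated (lagrangian H) c w}.Nonempty := by
  obtain ⟨B, hB⟩ := hH.exists_le_lagrangian
  refine ⟨B, fun _ => 0, continuous_const, fun a b γ hab _ hint => ?_⟩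
  rw [sub_self]
  exact intervalIntegral.integral_nonneg hab fun t _ => by linarith [hB (γ t) (velocity n γ t)]

omit [CompactSpace M] [IsManifold (𝓡 n) 1 M] [ConnectedSpace M] in
lemma ae_deriv_le_of_dominated {σ : ℝ → M} {a b c B : ℝ} {w : M → ℝ} (hab : a ≤ b)
    (hw : Dominated (lagrangian H) c w) (hB : ∀ x y, |w x - w y| ≤ B * dist x y)
    (hσ : AbsolutelyContinuousOnInterval σ a b)
    (hint : IntervalIntegrable (fun t => lagrangian H (σ t) (velocity n σ t) + c) volume a b) :
    ∀ᵐ t, t ∈ Ioo a b → deriv (fun t => w (σ t)) t ≤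
      lagrangian H (σ t) (velocity n σ t) + c :=
  (ac_comp_of_lipschitz hσ hB).ae_deriv_le hab hint fun s hs t ht hst => by
    have hsub : uIcc s t ⊆ uIcc a b := by
      rw [uIcc_of_le hab]; exact (convex_Icc a b).ordConnected.uIcc_subset hs ht
    exact hw s t σ hst (hσ.mono hsub) (hint.mono_set hsub)

omit [CompactSpace M] [IsManifold (𝓡 n) 1 M] [ConnectedSpace M] in
/-- A subsolution bounds the discounted action from below. -/
lemma Admissible.sub_le_action {lam c B D : ℝ} (hlam : 0 < lam) {x : M} {γ : ℝ → M}
    (h : Admissible H lam x γ) {w : M → ℝ} (hw : Dominated (lagrangian H) c w)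
    (hB : ∀ x y, |w x - w y| ≤ B * dist x y) (hD : ∀ x, |w x| ≤ D) :
    IntegrableOn (fun t => Real.exp (-lam * t) * w (γ t)) (Ioi 0) ∧
    lam * (∫ t in Ioi (0 : ℝ), Real.exp (-lam * t) * w (γ t)) - w x ≤
      discountedAction H lam γ + (c - criticalValue H) / lam := by
  have hexp := (exp_neg_integrableOn_Ioi 0 hlam).mul_const (c - criticalValue H)
  have h1 := discounted_integral_le (f := fun t => w (γ t))
    (a := fun t => cost H γ t + (c - criticalValue H)) hlam
    (fun T hT => ac_comp_of_lipschitz (h.ac T hT) hB) (fun t => hD _) (by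
      refine IntegrableOn.congr_fun (h.integrable.add hexp) (fun t _ => ?_) measurableSet_Ioi
      simp only [Pi.add_apply]
      ring) fun T hT => by
      have hi : IntervalIntegrable (fun t => lagrangian H (γ t) (velocity n γ t) + c)
          volume 0 T := by
        refine ((h.intervalIntegrable le_rfl hT).add
          (intervalIntegrable_const (c := c - criticalValue H))).congr fun t _ => ?_
        simp only [cost]
        ring
      filter_upwards [ae_deriv_le_of_dominated hT hw hB (h.ac T hT) hi] with t h2 ht
      refine (h2 ht).trans_eq ?_
      unfold cost
      ring
  refine ⟨h1.1, ?_⟩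
  have h2 : ∫ t in Ioi (0 : ℝ), Real.exp (-lam * t) * (cost H γ t + (c - criticalValue H)) =
      discountedAction H lam γ + (c - criticalValue H) / lam := by
    simp only [mul_add]
    rw [integral_add h.integrable hexp, integral_exp_neg_mul_Ioi hlam, discountedAction]
  rw [h2, h.zero] at h1
  exact h1.2

end Value
end WeakKAM

/-! ### Uniform bounds and convergence of the discounted values. -/

lemma abs_sub_le_of_tendsto {ι M : Type*} [PseudoMetricSpace M] {F : ι → M → ℝ} {v : M → ℝ}
    {l : Filter ι} [l.NeBot] {B : ℝ} (hF : ∀ᶠ i in l, ∀ x y, |F i x - F i y| ≤ B * dist x y)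
    (hv : ∀ x, Tendsto (fun i => F i x) l (𝓝 (v x))) (x y : M) :
    |v x - v y| ≤ B * dist x y :=
  le_of_tendsto ((hv x).sub (hv y)).abs (hF.mono fun _ hi => hi x y)

/-- Pointwise convergence of equi-Lipschitz functions on a compact space is uniform. -/
lemma tendstoUniformly_of_lipschitz {ι M : Type*} [PseudoMetricSpace M] [CompactSpace M]
    {F : ι → M → ℝ} {v : M → ℝ} {l : Filter ι} {B : ℝ}
    (hF : ∀ᶠ i in l, ∀ x y, |F i x - F i y| ≤ B * dist x y)
    (hv : ∀ x, Tendsto (fun i => F i x) l (𝓝 (v x))) : TendstoUniformly F v l := by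
  rcases l.eq_or_neBot with rfl | hl
  · simp [tendstoUniformly_iff_tendsto]
  have hvB := abs_sub_le_of_tendsto hF hv
  rw [Metric.tendstoUniformly_iff]
  intro ε hε
  set δ := ε / 3 / (|B| + 1) with hδ
  have hδ0 : 0 < δ := by positivity
  have hδB : ∀ d, 0 ≤ d → d < δ → B * d ≤ ε / 3 := by
    intro d hd0 hd
    calc B * d ≤ (|B| + 1) * δ :=
          mul_le_mul (by linarith [le_abs_self B]) hd.le hd0 (by positivity)
      _ = ε / 3 := by rw [hδ]; field_simp
  obtain ⟨t, -, ht, hcov⟩ := finite_cover_balls_of_compact (isCompact_univ (X := M)) hδ0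
  have hev : ∀ᶠ i in l, ∀ p ∈ t, dist (F i p) (v p) < ε / 3 :=
    (ht.eventually_all).2 fun p _ => (Metric.tendsto_nhds.1 (hv p)) _ (by positivity)
  filter_upwards [hF, hev] with i h1 h2 x
  obtain ⟨p, hp, hxp⟩ := mem_iUnion₂.1 (hcov (mem_univ x))
  have h3 := (hvB x p).trans (hδB _ dist_nonneg hxp)
  have h4 := (h1 x p).trans (hδB _ dist_nonneg hxp)
  have h5 := h2 p hp
  rw [Real.dist_eq] at h5 ⊢
  rw [abs_lt] at h5 ⊢
  rw [abs_le] at h3 h4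
  constructor <;> linarith

namespace WeakKAM

section Convergence

variable {n : ℕ} {M : Type*} [MetricSpace M] [CompactSpace M]
    [ChartedSpace (EuclideanSpace ℝ (Fin n)) M] [IsManifold (𝓡 n) 1 M] [ConnectedSpace M]
    {H : (x : M) → CotangentSpace n x → ℝ}

omit [IsManifold (𝓡 n) 1 M] [ConnectedSpace M] [ChartedSpace (EuclideanSpace ℝ (Fin n)) M] in
lemma mul_dist_le_abs_mul_diam (B : ℝ) (x y : M) :
    B * dist x y ≤ |B| * Metric.diam (univ : Set M) :=
  mul_le_mul (le_abs_self B) (Metric.dist_le_diam_of_mem isCompact_univ.isBounded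
    (mem_univ x) (mem_univ y)) dist_nonneg (abs_nonneg B)

/-- If V_λ exceeded the bound on its oscillation somewhere, it would have a positive lower bound m,
and -V_λ would be a continuous subsolution at level c(H) - λm, below the critical value. -/
lemma ConvexSuperlinear.exists_value_le (hH : ConvexSuperlinear H) (hM : BilipschitzCharts n M) :
    ∃ D : ℝ, ∀ lam : ℝ, 0 < lam → ∀ x : M, discountedValue H lam x ≤ D := by
  obtain ⟨B, hB⟩ := hH.exists_lipschitz_value hM
  refine ⟨|B| * Metric.diam (univ : Set M), fun lam hlam x => ?_⟩
  by_contra! hx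
  have h1 := hH.dominated_neg_value hM hlam
    (m := discountedValue H lam x - |B| * Metric.diam (univ : Set M)) fun y => by
      have := (le_abs_self _).trans ((hB lam hlam x y).trans (mul_dist_le_abs_mul_diam B x y))
      linarith
  have hcont : Continuous fun x => -discountedValue H lam x :=
    (LipschitzWith.of_dist_le_mul (K := B.toNNReal) fun x y => by
      rw [Real.dist_eq]
      exact (hB lam hlam x y).trans (by gcongr; exact B.le_coe_toNNReal)).continuous.neg
  have h2 : criticalValue H ≤ _ := csInf_le hH.bddBelow_dominated ⟨_, hcont, h1⟩
  have h3 := mul_pos hlam (sub_pos.2 hx)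
  linarith

/-- A subsolution at a level below c(H) + ε, normalized to vanish at x, is bounded by D
independently of ε ≤ 1. Integration by parts gives V_λ(x) ≥ -D - ε/λ, and ε tends to 0 with λ fixed,
so attainment of the critical value is not required. -/
lemma ConvexSuperlinear.exists_le_value (hH : ConvexSuperlinear H) (hM : BilipschitzCharts n M) :
    ∃ D : ℝ, ∀ lam : ℝ, 0 < lam → ∀ x : M, -D ≤ discountedValue H lam x := by
  obtain ⟨B, hB⟩ := hH.exists_lipschitz_of_dominated hM (criticalValue H + 1)
  refine ⟨|B| * Metric.diam (univ : Set M), fun lam hlam x => ?_⟩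
  set D := |B| * Metric.diam (univ : Set M) with hD
  have key : ∀ ε : ℝ, 0 < ε → ε ≤ 1 → -D - ε / lam ≤ discountedValue H lam x := by
    intro ε hε hε1
    obtain ⟨c, ⟨w, -, hw⟩, hc⟩ :=
      exists_lt_of_csInf_lt hH.nonempty_dominated (lt_add_of_pos_right (criticalValue H) hε)
    have hwB := hB c (by linarith) w hw
    have hw' : Dominated (lagrangian H) c (fun y => w y - w x) := fun a b γ hab hγ hint => by
      simpa using hw a b γ hab hγ hint
    have hwD : ∀ y, |w y - w x| ≤ D := fun y =>
      (hwB y x).trans (mul_dist_le_abs_mul_diam B y x)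
    refine le_discountedValue hlam fun γ hγ => ?_
    obtain ⟨hi, h1⟩ := hγ.sub_le_action hlam hw' (B := B) (by simpa using hwB) hwD
    have h2 : -D / lam ≤ ∫ t in Ioi (0 : ℝ), Real.exp (-lam * t) * (w (γ t) - w x) := by
      rw [← integral_exp_neg_mul_Ioi hlam]
      refine setIntegral_mono ((exp_neg_integrableOn_Ioi 0 hlam).mul_const _) hi fun t => ?_
      have := neg_le_of_abs_le (hwD (γ t))
      simp only
      gcongr
    rw [div_le_iff₀ hlam] at h2
    have h3 : (c - criticalValue H) / lam ≤ ε / lam := by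
      gcongr
      linarith
    linarith
  have hlim : Tendsto (fun ε : ℝ => -D - ε / lam) (𝓝[>] 0) (𝓝 (-D)) := by
    have : Tendsto (fun ε : ℝ => -D - ε / lam) (𝓝 0) (𝓝 (-D - 0 / lam)) :=
      Continuous.tendsto (by fun_prop) 0
    rw [zero_div, sub_zero] at this
    exact this.mono_left nhdsWithin_le_nhds
  refine le_of_tendsto hlim ?_
  filter_upwards [Ioc_mem_nhdsGT (zero_lt_one (α := ℝ))] with ε hε using key ε hε.1 hε.2

lemma ConvexSuperlinear.exists_abs_value_le (hH : ConvexSuperlinear H)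
    (hM : BilipschitzCharts n M) :
    ∃ D : ℝ, 0 ≤ D ∧ ∀ lam : ℝ, 0 < lam → ∀ x : M, |discountedValue H lam x| ≤ D := by
  obtain ⟨D, hD⟩ := hH.exists_value_le hM
  obtain ⟨D', hD'⟩ := hH.exists_le_value hM
  refine ⟨max |D| |D'|, le_max_of_le_left (abs_nonneg _), fun lam hlam x => abs_le.2 ⟨?_, ?_⟩⟩
  · linarith [hD' lam hlam x, le_max_right |D| |D'|, le_abs_self D']
  · exact (hD lam hlam x).trans ((le_abs_self D).trans (le_max_left _ _))

lemma ConvexSuperlinear.dominated_neg_of_tendsto (hH : ConvexSuperlinear H)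
    (hM : BilipschitzCharts n M) {l : Filter ℝ} [l.NeBot] (hl : l ≤ 𝓝[>] 0) {v : M → ℝ}
    (hv : ∀ x, Tendsto (fun lam => discountedValue H lam x) l (𝓝 (v x))) :
    Dominated (lagrangian H) (criticalValue H) (fun x => -v x) := by
  obtain ⟨D, hD0, hD⟩ := hH.exists_abs_value_le hM
  intro a b γ hab hγ hint
  have hlim : Tendsto (fun lam => (∫ t in a..b, (lagrangian H (γ t) (velocity n γ t) +
      criticalValue H)) + lam * D * (b - a)) l (𝓝 ((∫ t in a..b,
        (lagrangian H (γ t) (velocity n γ t) + criticalValue H)) + 0 * D * (b - a))) :=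
    (Continuous.tendsto (by fun_prop) 0).mono_left (hl.trans nhdsWithin_le_nhds)
  rw [zero_mul, zero_mul, add_zero] at hlim
  refine le_of_tendsto_of_tendsto ((hv (γ b)).neg.sub (hv (γ a)).neg) hlim ?_
  filter_upwards [hl self_mem_nhdsWithin] with lam hlam
  have h1 := hH.dominated_neg_value hM hlam (m := -D) (fun x => neg_le_of_abs_le (hD lam hlam x))
    a b γ hab hγ
  have h2 : (fun t => lagrangian H (γ t) (velocity n γ t) + (criticalValue H - lam * -D)) =
      fun t => (lagrangian H (γ t) (velocity n γ t) + criticalValue H) + lam * D := by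
    ext t; ring
  rw [h2] at h1
  refine (h1 (hint.add intervalIntegrable_const)).trans_eq ?_
  rw [intervalIntegral.integral_add hint intervalIntegrable_const,
    intervalIntegral.integral_const, smul_eq_mul]
  ring

/-- A discounted value is small in the mean along nearly optimal curves of smaller discount. -/
lemma ConvexSuperlinear.sub_mul_integral_value_le (hH : ConvexSuperlinear H)
    (hM : BilipschitzCharts n M) {lam lam' : ℝ} (hlam : 0 < lam) (hlam' : 0 < lam') {x : M}
    {γ : ℝ → M} (h : Admissible H lam x γ) :
    IntegrableOn (fun t => Real.exp (-lam * t) * discountedValue H lam' (γ t)) (Ioi 0) ∧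
    (lam' - lam) * (∫ t in Ioi (0 : ℝ), Real.exp (-lam * t) * discountedValue H lam' (γ t)) ≤
      discountedAction H lam γ - discountedValue H lam' x := by
  obtain ⟨D, hD0, hD⟩ := hH.exists_abs_value_le hM
  obtain ⟨B, hB⟩ := hH.exists_lipschitz_value hM
  have hAC : ∀ T, 0 ≤ T → AbsolutelyContinuousOnInterval
      (fun t => -discountedValue H lam' (γ t)) 0 T := fun T hT =>
    (ac_comp_of_lipschitz (h.ac T hT) (hB lam' hlam')).fun_neg
  have hcont : ContinuousOn (fun t => discountedValue H lam' (γ t)) (Ioi 0) := fun t ht => by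
    have := ((hAC (t + 1) (by linarith [mem_Ioi.1 ht])).continuousAt
      ⟨ht, by linarith⟩).fun_neg.continuousWithinAt (s := Ioi 0)
    simpa using this
  have hi : IntegrableOn (fun t => Real.exp (-lam * t) * discountedValue H lam' (γ t))
      (Ioi 0) := by
    refine Integrable.mono' ((exp_neg_integrableOn_Ioi 0 hlam).mul_const D)
      (ContinuousOn.aestronglyMeasurable (by fun_prop) measurableSet_Ioi)
      (Eventually.of_forall fun t => ?_)
    rw [norm_mul, Real.norm_of_nonneg (Real.exp_pos _).le, Real.norm_eq_abs]
    gcongr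
    exact hD _ hlam' _
  refine ⟨hi, ?_⟩
  have hsub : ∀ t, Real.exp (-lam * t) * (cost H γ t - lam' * discountedValue H lam' (γ t)) =
      Real.exp (-lam * t) * cost H γ t -
        lam' * (Real.exp (-lam * t) * discountedValue H lam' (γ t)) := fun t => by ring
  -- Two discounts meet here: integration by parts produces the factor λ, the subsolution inequality
  -- for V_λ' the factor λ'. Collecting them gives λ' - λ.
  have h1 := (discounted_integral_le (f := fun t => -discountedValue H lam' (γ t))
    (a := fun t => cost H γ t - lam' * discountedValue H lam' (γ t)) hlam hAC
    (fun t => by rw [abs_neg]; exact hD _ hlam' _) (by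
      simp only [hsub]
      exact h.integrable.sub (hi.const_mul lam'))
    fun T hT => hH.ae_deriv_value_ge hM hlam' hT (h.ac T hT) (h.intervalIntegrable le_rfl hT)).2
  simp only [hsub] at h1
  rw [integral_sub h.integrable (hi.const_mul lam'), integral_const_mul] at h1
  simp only [mul_neg, integral_neg, h.zero] at h1
  rw [discountedAction]
  linarith

/-- A nearly optimal curve for small λ is tested against two functions: the critical subsolution -v'
and the value V_λ', uniformly close to v'. The first bounds v'(x) by V_λ(x) and the λ-average of v'
along the curve; the second shows that this average is at most small. -/
lemma ConvexSuperlinear.le_of_tendsto_value (hH : ConvexSuperlinear H)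
    (hM : BilipschitzCharts n M) {l l' : Filter ℝ} [l.NeBot] [l'.NeBot] (hl : l ≤ 𝓝[>] 0)
    (hl' : l' ≤ 𝓝[>] 0) {v v' : M → ℝ}
    (hv : ∀ x, Tendsto (fun lam => discountedValue H lam x) l (𝓝 (v x)))
    (hv' : ∀ x, Tendsto (fun lam => discountedValue H lam x) l' (𝓝 (v' x))) (x : M) :
    v' x ≤ v x := by
  obtain ⟨D, hD0, hD⟩ := hH.exists_abs_value_le hM
  obtain ⟨B, hB⟩ := hH.exists_lipschitz_value hM
  have hBl' : ∀ᶠ lam in l', ∀ x y : M,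
      |discountedValue H lam x - discountedValue H lam y| ≤ B * dist x y := by
    filter_upwards [hl' self_mem_nhdsWithin] with lam hlam using hB lam hlam
  have hv'B := abs_sub_le_of_tendsto hBl' hv'
  have hv'D : ∀ y, |v' y| ≤ D := fun y => le_of_tendsto (hv' y).abs (by
    filter_upwards [hl' self_mem_nhdsWithin] with lam hlam using hD lam hlam y)
  have hdom := hH.dominated_neg_of_tendsto hM hl' hv'
  refine le_of_forall_pos_le_add fun η' hη' => ?_
  obtain ⟨η, hη, rfl⟩ : ∃ η : ℝ, 0 < η ∧ η' = 2 * η := ⟨η' / 2, by positivity, by ring⟩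
  have hpos : ∀ᶠ lam in l', 0 < lam := hl' self_mem_nhdsWithin
  obtain ⟨lam', hlam', hη1⟩ := (hpos.and (Metric.tendstoUniformly_iff.1
    (tendstoUniformly_of_lipschitz hBl' hv') η hη)).exists
  have key : ∀ lam, 0 < lam → lam < lam' →
      v' x ≤ discountedValue H lam x + 2 * η + lam * ((2 * D + η) / (lam' - lam)) := by
    intro lam hlam hlt
    obtain ⟨γ, hγ, hJ⟩ := exists_discountedAction_lt (H := H) hlam x hη
    obtain ⟨hi1, h1⟩ := hγ.sub_le_action hlam hdom (B := B) (D := D)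
      (fun y z => by
        rw [neg_sub_neg, abs_sub_comm]; exact hv'B y z) (fun y => by rw [abs_neg]; exact hv'D y)
    obtain ⟨hi2, h2⟩ := hH.sub_mul_integral_value_le hM hlam hlam' hγ
    have hi3 := (exp_neg_integrableOn_Ioi 0 hlam).mul_const (-η)
    have h3 : (∫ t in Ioi (0 : ℝ), Real.exp (-lam * t) * (-η)) ≤
        (∫ t in Ioi (0 : ℝ), Real.exp (-lam * t) * -v' (γ t)) +
        ∫ t in Ioi (0 : ℝ), Real.exp (-lam * t) * discountedValue H lam' (γ t) := by
      rw [← integral_add hi1 hi2]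
      refine setIntegral_mono hi3 (hi1.add hi2) fun t => ?_
      have h4 := hη1 (γ t)
      rw [Real.dist_eq, abs_lt] at h4
      have h5 := mul_le_mul_of_nonneg_left (show -η ≤ -v' (γ t) + discountedValue H lam' (γ t) by
        linarith) (Real.exp_pos (-lam * t)).le
      simpa [mul_add] using h5
    rw [integral_exp_neg_mul_Ioi hlam, div_le_iff₀ hlam] at h3
    -- With λ' fixed this bound stays finite as λ → 0, so the factor λ in front of the integral
    -- removes it in the limit.
    have h6 : (∫ t in Ioi (0 : ℝ), Real.exp (-lam * t) * discountedValue H lam' (γ t)) ≤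
        (2 * D + η) / (lam' - lam) := by
      rw [le_div_iff₀ (by linarith)]
      have h7 := abs_le.1 (hD lam hlam x)
      have h8 := abs_le.1 (hD lam' hlam' x)
      linarith
    have h9 := mul_le_mul_of_nonneg_left h6 hlam.le
    simp only [sub_self, zero_div, add_zero] at h1
    linarith
  have hlim : Tendsto (fun lam => discountedValue H lam x + 2 * η +
      lam * ((2 * D + η) / (lam' - lam))) l
      (𝓝 (v x + 2 * η + 0 * ((2 * D + η) / (lam' - 0)))) := by
    refine ((hv x).add_const _).add (Tendsto.mono_left ?_ (hl.trans nhdsWithin_le_nhds))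
    refine tendsto_id.mul (tendsto_const_nhds.div (tendsto_const_nhds.sub tendsto_id) ?_)
    simpa using hlam'.ne'
  rw [zero_mul, add_zero] at hlim
  refine ge_of_tendsto hlim ?_
  filter_upwards [hl (Ioo_mem_nhdsGT hlam')] with lam hlam using key lam hlam.1 hlam.2

/-- The discounted values converge when the discount tends to zero. -/
theorem ConvexSuperlinear.exists_tendstoUniformly_value (hH : ConvexSuperlinear H)
    (hM : BilipschitzCharts n M) :
    ∃ (v : M → ℝ) (B : ℝ), (∀ x y, |v x - v y| ≤ B * dist x y) ∧
      TendstoUniformly (fun (lam : ℝ) x => discountedValue H lam x) v (𝓝[>] 0) ∧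
      Dominated (lagrangian H) (criticalValue H) (fun x => -v x) := by
  obtain ⟨D, hD0, hD⟩ := hH.exists_abs_value_le hM
  obtain ⟨B, hB⟩ := hH.exists_lipschitz_value hM
  have hlim : ∀ U : Ultrafilter ℝ, (U : Filter ℝ) ≤ 𝓝[>] 0 →
      ∃ v : M → ℝ, ∀ x, Tendsto (fun lam => discountedValue H lam x) U (𝓝 (v x)) := by
    intro U hU
    have : ∀ x : M, ∃ r : ℝ, Tendsto (fun lam => discountedValue H lam x) U (𝓝 r) := by
      intro x
      obtain ⟨r, -, hr⟩ := (isCompact_Icc (a := -D) (b := D)).ultrafilter_le_nhds'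
        (U.map fun lam => discountedValue H lam x) (by
          refine Ultrafilter.mem_map.2 ?_
          filter_upwards [hU self_mem_nhdsWithin] with lam hlam using abs_le.1 (hD lam hlam x))
      exact ⟨r, hr⟩
    choose v hv using this
    exact ⟨v, hv⟩
  obtain ⟨v, hv⟩ := hlim (Ultrafilter.of (𝓝[>] 0)) (Ultrafilter.of_le _)
  -- Along every ultrafilter finer than 𝓝[>] 0 there is a limit by boundedness;
  -- `le_of_tendsto_value` applied in both directions shows that all these limits agree.
  have hconv : ∀ x, Tendsto (fun lam => discountedValue H lam x) (𝓝[>] 0) (𝓝 (v x)) := by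
    intro x
    rw [tendsto_iff_ultrafilter]
    intro U hU
    obtain ⟨v', hv'⟩ := hlim U hU
    rw [le_antisymm (hH.le_of_tendsto_value hM hU (Ultrafilter.of_le _) hv' hv x)
      (hH.le_of_tendsto_value hM (Ultrafilter.of_le _) hU hv hv' x)]
    exact hv' x
  have hBl : ∀ᶠ lam in 𝓝[>] (0 : ℝ), ∀ x y : M,
      |discountedValue H lam x - discountedValue H lam y| ≤ B * dist x y := by
    filter_upwards [self_mem_nhdsWithin] with lam hlam using hB lam hlam
  exact ⟨v, B, abs_sub_le_of_tendsto hBl hconv, tendstoUniformly_of_lipschitz hBl hconv,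
    hH.dominated_neg_of_tendsto hM le_rfl hconv⟩

end Convergence
end WeakKAM

/-! ### Limits of nearly optimal curves and calibration. -/

lemma HasDerivAt.nonneg_of_eventually_le {φ : ℝ → ℝ} {φ' t : ℝ} (hφ : HasDerivAt φ φ' t)
    (h : ∀ᶠ s in 𝓝[>] t, φ t ≤ φ s) : 0 ≤ φ' := by
  have h1 := (hasDerivAt_iff_tendsto_slope.1 hφ).mono_left (nhdsGT_le_nhdsNE t)
  refine ge_of_tendsto h1 ?_
  filter_upwards [h, self_mem_nhdsWithin] with s hs hts
  rw [slope_def_field]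
  exact div_nonneg (by linarith) (by linarith [mem_Ioi.1 hts])

namespace WeakKAM

section Calibrated

variable {n : ℕ} {M : Type*} [MetricSpace M] [CompactSpace M]
    [ChartedSpace (EuclideanSpace ℝ (Fin n)) M] [IsManifold (𝓡 n) 1 M]
    {H : (x : M) → CotangentSpace n x → ℝ}

omit [CompactSpace M] in
/-- Fenchel's inequality along a curve that stays in a chart. -/
lemma ConvexSuperlinear.apply_extChartAt_sub_le (hH : ConvexSuperlinear H)
    (hM : BilipschitzCharts n M) {x : M} {U : Set M} {C : ℝ}
    (hU : U ⊆ (extChartAt (𝓡 n) x).source)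
    (hUC : ∀ y ∈ U, ∀ z ∈ U, ‖extChartAt (𝓡 n) x y - extChartAt (𝓡 n) x z‖ ≤ C * dist y z)
    {σ : ℝ → M} {a b c : ℝ} (hab : a ≤ b) (hσ : AbsolutelyContinuousOnInterval σ a b)
    (hint : IntervalIntegrable (fun t => lagrangian H (σ t) (velocity n σ t)) volume a b)
    (hσU : ∀ t ∈ Icc a b, σ t ∈ U) {q : EuclideanSpace ℝ (Fin n) →L[ℝ] ℝ}
    (hq : ∀ y ∈ U, coordHamiltonian H x y q ≤ c) :
    q (extChartAt (𝓡 n) x (σ b)) - q (extChartAt (𝓡 n) x (σ a)) ≤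
      ∫ t in a..b, (lagrangian H (σ t) (velocity n σ t) + c) := by
  have hf : AbsolutelyContinuousOnInterval (fun t => q (extChartAt (𝓡 n) x (σ t))) a b :=
    hσ.of_dist_le_mul (C := ‖q‖ * C) fun s hs t ht => by
      rw [uIcc_of_le hab] at hs ht
      rw [Real.dist_eq, ← map_sub, ← Real.norm_eq_abs, mul_assoc]
      exact (q.le_opNorm _).trans (by gcongr; exact hUC _ (hσU s hs) _ (hσU t ht))
  refine hf.sub_le_integral hab (hint.add intervalIntegrable_const) ?_
  filter_upwards [ae_mdifferentiableAt hM hσ] with t h1 ht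
  have htU := hσU t (Ioo_subset_Icc_self ht)
  have h2 := (differentiableAt_extChartAt_comp (h1 ht) (hU htU)).hasDerivAt
  have h3 := (q.hasFDerivAt.comp_hasDerivAt t h2).deriv
  have h4 : deriv (fun t => q (extChartAt (𝓡 n) x (σ t))) t =
      q (tangentCoord x (σ t) (velocity n σ t)) := by
    rw [tangentCoord_velocity (hσ.continuousAt ht) (hU htU)]
    exact h3
  rw [h4]
  linarith [hH.apply_sub_le_lagrangian x (σ t) (velocity n σ t) q, hq _ htU]

/-- On a bounded time interval the discount weights differ from 1 by O(λ), so removing them from the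
near-optimality estimate costs only O(λ). -/
lemma ConvexSuperlinear.exists_integral_cost_le [ConnectedSpace M] (hH : ConvexSuperlinear H)
    (hM : BilipschitzCharts n M) {T : ℝ} (hT : 0 ≤ T) :
    ∃ E : ℝ, 0 ≤ E ∧ ∀ lam : ℝ, 0 < lam → lam ≤ 1 → ∀ (x : M) (γ : ℝ → M),
      Admissible H lam x γ → discountedAction H lam γ ≤ discountedValue H lam x + lam →
      ∀ s t : ℝ, 0 ≤ s → s ≤ t → t ≤ T →
        ∫ r in s..t, cost H γ r ≤
          discountedValue H lam (γ s) - discountedValue H lam (γ t) + lam * E := by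
  obtain ⟨D, hD0, hD⟩ := hH.exists_abs_value_le hM
  obtain ⟨C, hC0, hC, -⟩ := hH.exists_cost_bounds
  refine ⟨Real.exp T * (D * T + 1 + C * T * T), by positivity,
    fun lam hlam hlam1 x γ h hJ s t hs hst htT => ?_⟩
  have hexp : ∀ r, 0 ≤ r → r ≤ T → Real.exp (lam * r) - 1 ≤ lam * (T * Real.exp T) := by
    intro r hr hrT
    have h1 : Real.exp (lam * r) ≤ Real.exp T := Real.exp_le_exp.2 (by nlinarith)
    have h2 : Real.exp (lam * r) * (1 - lam * r) ≤ 1 := by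
      have h3 := Real.add_one_le_exp (-(lam * r))
      calc Real.exp (lam * r) * (1 - lam * r)
          ≤ Real.exp (lam * r) * Real.exp (-(lam * r)) := by gcongr; linarith
        _ = 1 := by rw [← Real.exp_add]; simp
    have h3 : lam * r * Real.exp (lam * r) ≤ lam * T * Real.exp T := by gcongr
    linarith
  have hi := h.intervalIntegrable hs hst
  have hie := h.intervalIntegrable_exp_mul hs hst
  have hied : IntervalIntegrable (fun r => Real.exp (-lam * r) * C) volume s t :=
    Continuous.intervalIntegrable (by fun_prop) _ _
  have h1 := h.integral_le hH hlam hJ hs hst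
  -- Adding C makes the integrand nonnegative, so it may be multiplied by e^{λ(t-r)} ≥ 1.
  have h2 : ∫ r in s..t, (cost H γ r + C) ≤
      ∫ r in s..t, Real.exp (lam * t) * (Real.exp (-lam * r) * cost H γ r +
        Real.exp (-lam * r) * C) := by
    refine intervalIntegral.integral_mono_on hst (hi.add intervalIntegrable_const)
      ((hie.add hied).const_mul _) fun r hr => ?_
    have h3 : 1 ≤ Real.exp (lam * t) * Real.exp (-lam * r) := by
      rw [← Real.exp_add]
      exact Real.one_le_exp (by nlinarith [hr.2])
    nlinarith [hC γ r]
  have h3 : ∫ r in s..t, Real.exp (-lam * r) * C ≤ ∫ _ in s..t, C := by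
    refine intervalIntegral.integral_mono_on hst hied intervalIntegrable_const fun r hr => ?_
    exact mul_le_of_le_one_left hC0 (Real.exp_le_one_iff.2 (by nlinarith [hr.1]))
  rw [intervalIntegral.integral_const_mul, intervalIntegral.integral_add hie hied,
    intervalIntegral.integral_add hi intervalIntegrable_const] at h2
  rw [intervalIntegral.integral_const, smul_eq_mul] at h2 h3
  have h4 : (∫ r in s..t, cost H γ r) + (t - s) * C ≤ Real.exp (lam * t) *
      (Real.exp (-lam * s) * discountedValue H lam (γ s) -
        Real.exp (-lam * t) * discountedValue H lam (γ t) + lam + (t - s) * C) := by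
    refine h2.trans ?_
    gcongr
  have h5 : Real.exp (lam * t) * (Real.exp (-lam * s) * discountedValue H lam (γ s) -
        Real.exp (-lam * t) * discountedValue H lam (γ t) + lam + (t - s) * C) =
      Real.exp (lam * (t - s)) * discountedValue H lam (γ s) - discountedValue H lam (γ t) +
        Real.exp (lam * t) * lam + Real.exp (lam * t) * ((t - s) * C) := by
    have e1 : Real.exp (lam * t) * Real.exp (-lam * s) = Real.exp (lam * (t - s)) := by
      rw [← Real.exp_add]; ring_nf
    have e2 : Real.exp (lam * t) * Real.exp (-lam * t) = 1 := by
      rw [← Real.exp_add]; simp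
    linear_combination discountedValue H lam (γ s) * e1 - discountedValue H lam (γ t) * e2
  rw [h5] at h4
  have h6 : (Real.exp (lam * (t - s)) - 1) * discountedValue H lam (γ s) ≤
      lam * (T * Real.exp T) * D := by
    have e1 : 0 ≤ Real.exp (lam * (t - s)) - 1 := by
      linarith [Real.one_le_exp (show 0 ≤ lam * (t - s) by nlinarith)]
    exact (mul_le_mul_of_nonneg_left (le_of_abs_le (hD lam hlam _)) e1).trans
      (mul_le_mul_of_nonneg_right (hexp _ (by linarith) (by linarith)) hD0)
  have h7 : (Real.exp (lam * t) - 1) * ((t - s) * C) ≤ lam * (T * Real.exp T) * (T * C) :=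
    mul_le_mul (hexp t (by linarith) htT) (by gcongr; linarith)
      (mul_nonneg (by linarith) hC0) (by positivity)
  have h8 : Real.exp (lam * t) * lam ≤ Real.exp T * lam := by
    gcongr
    nlinarith
  linarith

variable [ConnectedSpace M]

/-- Nearly optimal curves are Lipschitz up to an error that vanishes with the discount. -/
lemma ConvexSuperlinear.exists_dist_le (hH : ConvexSuperlinear H) (hM : BilipschitzCharts n M) :
    ∃ B : ℝ, 0 ≤ B ∧ ∀ T : ℝ, 0 ≤ T → ∃ E : ℝ, ∀ lam : ℝ, 0 < lam → lam ≤ 1 →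
      ∀ (x : M) (γ : ℝ → M), Admissible H lam x γ →
      discountedAction H lam γ ≤ discountedValue H lam x + lam →
      ∀ s t : ℝ, 0 ≤ s → s ≤ t → t ≤ T → dist (γ s) (γ t) ≤ B * (t - s) + lam * E := by
  obtain ⟨B, hB⟩ := hH.exists_lipschitz_value hM
  -- The slope exceeds the Lipschitz constant of V_λ by one: after the decrease of V_λ is absorbed,
  -- one copy of the distance is left on the left-hand side.
  obtain ⟨B', hB'⟩ := hH.exists_mul_dist_le_integral hM (K := |B| + 1) (by positivity)
  refine ⟨|B' - criticalValue H|, abs_nonneg _, fun T hT => ?_⟩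
  obtain ⟨E, -, hE⟩ := hH.exists_integral_cost_le hM hT
  refine ⟨E, fun lam hlam hlam1 x γ h hJ s t hs hst htT => ?_⟩
  have hi := h.intervalIntegrable hs hst
  have hi' : IntervalIntegrable (fun t => lagrangian H (γ t) (velocity n γ t)) volume s t := by
    refine (hi.sub (intervalIntegrable_const (c := criticalValue H))).congr fun r _ => ?_
    simp [cost]
  have h1 := hB' γ s t hst (h.ac_of_le hs hst) hi'
  have h2 := hE lam hlam hlam1 x γ h hJ s t hs hst htT
  have h3 : ∫ r in s..t, (lagrangian H (γ r) (velocity n γ r) + B') =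
      (∫ r in s..t, cost H γ r) + (t - s) * (B' - criticalValue H) := by
    rw [← smul_eq_mul, ← intervalIntegral.integral_const, ← intervalIntegral.integral_add hi
      intervalIntegrable_const]
    congr 1
    ext r
    rw [cost]
    ring
  have h4 := (le_abs_self _).trans (hB lam hlam (γ s) (γ t))
  have h5 : B * dist (γ s) (γ t) ≤ |B| * dist (γ s) (γ t) := by
    gcongr
    exact le_abs_self B
  have h6 : (t - s) * (B' - criticalValue H) ≤ (t - s) * |B' - criticalValue H| :=
    mul_le_mul_of_nonneg_left (le_abs_self _) (by linarith)
  linarith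

lemma ConvexSuperlinear.exists_lipschitz_limit (hH : ConvexSuperlinear H)
    (hM : BilipschitzCharts n M) {l : Filter ℝ} [l.NeBot] (hl : l ≤ 𝓝[>] 0) {x : M}
    {Γ : ℝ → ℝ → M} (hΓ : ∀ lam, 0 < lam → Admissible H lam x (Γ lam) ∧
      discountedAction H lam (Γ lam) ≤ discountedValue H lam x + lam)
    {γ : ℝ → M} (hγ : ∀ t, Tendsto (fun lam => Γ lam t) l (𝓝 (γ t))) :
    ∃ B : ℝ, ∀ s t, 0 ≤ s → s ≤ t → dist (γ s) (γ t) ≤ B * (t - s) := by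
  obtain ⟨B, -, hB⟩ := hH.exists_dist_le hM
  refine ⟨B, fun s t hs hst => ?_⟩
  obtain ⟨E, hE⟩ := hB t (hs.trans hst)
  have hlim : Tendsto (fun lam : ℝ => B * (t - s) + lam * E) l (𝓝 (B * (t - s) + 0 * E)) :=
    (Continuous.tendsto (by fun_prop) 0).mono_left (hl.trans nhdsWithin_le_nhds)
  rw [zero_mul, add_zero] at hlim
  refine le_of_tendsto_of_tendsto ((hγ s).dist (hγ t)) hlim ?_
  filter_upwards [hl (Ioc_mem_nhdsGT zero_lt_one)] with lam hlam
  exact hE lam hlam.1 hlam.2 x _ (hΓ lam hlam.1).1 (hΓ lam hlam.1).2 s t hs hst le_rfl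

/-- The cost of a limit of nearly optimal curves is at most the decrease of the limit value. -/
lemma ConvexSuperlinear.cost_le_deriv (hH : ConvexSuperlinear H)
    (hM : BilipschitzCharts n M) {l : Filter ℝ} [l.NeBot] (hl : l ≤ 𝓝[>] 0) {x : M}
    {Γ : ℝ → ℝ → M} (hΓ : ∀ lam, 0 < lam → Admissible H lam x (Γ lam) ∧
      discountedAction H lam (Γ lam) ≤ discountedValue H lam x + lam)
    {γ : ℝ → M} (hγ : ∀ t, Tendsto (fun lam => Γ lam t) l (𝓝 (γ t))) {v : M → ℝ}
    (hv : TendstoUniformly (fun (lam : ℝ) x => discountedValue H lam x) v l)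
    (hvc : Continuous v) {t₀ : ℝ} (ht₀ : 0 < t₀)
    (hd : MDifferentiableAt 𝓘(ℝ, ℝ) (𝓡 n) γ t₀)
    (hg : DifferentiableAt ℝ (fun t => -v (γ t)) t₀) :
    cost H γ t₀ ≤ deriv (fun t => -v (γ t)) t₀ := by
  have hx₀ := mem_extChartAt_source (I := 𝓡 n) (γ t₀)
  have he := (differentiableAt_extChartAt_comp hd hx₀).hasDerivAt
  obtain ⟨C, hC, U, hU, hUs, hUC⟩ := hM (γ t₀)
  obtain ⟨B, hB0, hB⟩ := hH.exists_dist_le hM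
  obtain ⟨E, hE⟩ := hB (t₀ + 1) (by linarith)
  obtain ⟨E', -, hE'⟩ := hH.exists_integral_cost_le hM (T := t₀ + 1) (by linarith)
  -- It suffices to bound each Fenchel term at γ t₀. Keeping the coordinates of q fixed near γ t₀
  -- changes the Hamiltonian by at most η.
  rw [cost, ← le_sub_iff_add_le, lagrangian_eq_iSup_coord hx₀]
  refine ciSup_le fun q => ?_
  rw [tangentCoord_velocity hd.continuousAt hx₀]
  refine le_of_forall_pos_le_add fun η hη => ?_
  set c := coordHamiltonian H (γ t₀) (γ t₀) q + η with hc
  have hH0 : ∀ᶠ y in 𝓝 (γ t₀), coordHamiltonian H (γ t₀) y q ≤ c := by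
    have h1 : ContinuousAt (fun y => coordHamiltonian H (γ t₀) y q) (γ t₀) :=
      (hH.continuousAt_coordHamiltonian hx₀ q).comp (f := fun y => (y, q)) (by fun_prop)
    exact (h1.eventually (gt_mem_nhds (lt_add_of_pos_right _ hη))).mono fun y hy => hy.le
  obtain ⟨ρ, hρ, hball⟩ := Metric.mem_nhds_iff.1 (inter_mem hU hH0)
  have hnear : ∀ᶠ t in 𝓝[>] t₀, t₀ < t ∧ t < t₀ + 1 ∧ B * (t - t₀) < ρ / 3 := by
    have h1 : Tendsto (fun t => B * (t - t₀)) (𝓝[>] t₀) (𝓝 (B * (t₀ - t₀))) :=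
      (Continuous.tendsto (by fun_prop) t₀).mono_left nhdsWithin_le_nhds
    rw [sub_self, mul_zero] at h1
    filter_upwards [Ioo_mem_nhdsGT (lt_add_one t₀),
      h1.eventually (gt_mem_nhds (show 0 < ρ / 3 by positivity))] with t ht1 ht2
    exact ⟨ht1.1, ht1.2, ht2⟩
  have hsmall : ∀ᶠ lam in l, 0 < lam ∧ lam ≤ 1 ∧ lam * E < ρ / 3 ∧
      dist (Γ lam t₀) (γ t₀) < ρ / 3 := by
    have h1 : Tendsto (fun lam : ℝ => lam * E) l (𝓝 (0 * E)) :=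
      (Continuous.tendsto (by fun_prop) 0).mono_left (hl.trans nhdsWithin_le_nhds)
    rw [zero_mul] at h1
    filter_upwards [hl (Ioc_mem_nhdsGT zero_lt_one),
      h1.eventually (gt_mem_nhds (show 0 < ρ / 3 by positivity)),
      Metric.tendsto_nhds.1 (hγ t₀) (ρ / 3) (by positivity)] with lam h1 h2 h3
    exact ⟨h1.1, h1.2, h2, h3⟩
  have hvlim : ∀ t, Tendsto (fun lam => discountedValue H lam (Γ lam t)) l (𝓝 (v (γ t))) :=
    fun t => hv.tendsto_comp hvc.continuousAt (hγ t)
  have key : ∀ᶠ t in 𝓝[>] t₀, q (extChartAt (𝓡 n) (γ t₀) (γ t)) -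
      q (extChartAt (𝓡 n) (γ t₀) (γ t₀)) ≤
        v (γ t₀) - v (γ t) + (t - t₀) * (c - criticalValue H) := by
    have hcont : ∀ᶠ t in 𝓝[>] t₀, γ t ∈ (extChartAt (𝓡 n) (γ t₀)).source :=
      (hd.continuousAt.eventually (extChartAt_source_mem_nhds (γ t₀))).filter_mono
        nhdsWithin_le_nhds
    filter_upwards [hnear, hcont] with t ⟨ht, ht1, htB⟩ hts
    have hq : ∀ s, γ s ∈ (extChartAt (𝓡 n) (γ t₀)).source →
        Tendsto (fun lam => q (extChartAt (𝓡 n) (γ t₀) (Γ lam s))) l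
          (𝓝 (q (extChartAt (𝓡 n) (γ t₀) (γ s)))) := fun s hs =>
      (q.continuous.tendsto _).comp ((continuousAt_extChartAt' hs).tendsto.comp (hγ s))
    have hlim : Tendsto (fun lam => discountedValue H lam (Γ lam t₀) -
        discountedValue H lam (Γ lam t) + lam * E' + (t - t₀) * (c - criticalValue H)) l
        (𝓝 (v (γ t₀) - v (γ t) + 0 * E' + (t - t₀) * (c - criticalValue H))) :=
      (((hvlim t₀).sub (hvlim t)).add ((Continuous.tendsto (f := fun lam : ℝ => lam * E')
        (by fun_prop) 0).mono_left (hl.trans nhdsWithin_le_nhds))).add_const _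
    rw [zero_mul, add_zero] at hlim
    -- Only the positions of Γ lam at t₀ and t occur in the inequality, so pointwise convergence of
    -- the curves is enough.
    refine le_of_tendsto_of_tendsto ((hq t hts).sub (hq t₀ hx₀)) hlim ?_
    filter_upwards [hsmall] with lam ⟨hlam, hlam1, hlamE, hlamd⟩
    obtain ⟨hadm, hJ⟩ := hΓ lam hlam
    have hi := hadm.intervalIntegrable ht₀.le ht.le
    have hi' : IntervalIntegrable
        (fun t => lagrangian H (Γ lam t) (velocity n (Γ lam) t)) volume t₀ t := by
      refine (hi.sub (intervalIntegrable_const (c := criticalValue H))).congr fun r _ => ?_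
      simp [cost]
    -- Three contributions, each below ρ/3: the Lipschitz displacement, the error λE, and the
    -- distance between the two curves at t₀.
    have hstay : ∀ r ∈ Icc t₀ t, Γ lam r ∈ Metric.ball (γ t₀) ρ := by
      intro r hr
      have h1 := hE lam hlam hlam1 x _ hadm hJ t₀ r ht₀.le hr.1 (hr.2.trans ht1.le)
      have h2 : B * (r - t₀) ≤ B * (t - t₀) := by
        gcongr
        exact hr.2
      rw [Metric.mem_ball]
      linarith [dist_triangle_left (Γ lam r) (γ t₀) (Γ lam t₀)]
    have h1 := hH.apply_extChartAt_sub_le hM (x := γ t₀) (U := Metric.ball (γ t₀) ρ) (C := C)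
      (fun y hy => hUs (hball hy).1)
      (fun y hy z hz => (hUC y (hball hy).1 z (hball hz).1).2) ht.le
      (hadm.ac_of_le ht₀.le ht.le) hi' hstay (q := q) (c := c) fun y hy => (hball hy).2
    have h2 := hE' lam hlam hlam1 x _ hadm hJ t₀ t ht₀.le ht.le ht1.le
    have h3 : ∫ r in t₀..t, (lagrangian H (Γ lam r) (velocity n (Γ lam) r) + c) =
        (∫ r in t₀..t, cost H (Γ lam) r) + (t - t₀) * (c - criticalValue H) := by
      rw [← smul_eq_mul, ← intervalIntegral.integral_const, ← intervalIntegral.integral_add hi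
        intervalIntegrable_const]
      congr 1
      ext r
      rw [cost]
      ring
    linarith
  -- By `key` this function is, to the right of t₀, at least its value at t₀; its nonnegative
  -- derivative there is the inequality sought.
  have hφ := (hg.hasDerivAt.fun_add ((hasDerivAt_id t₀).mul_const (c - criticalValue H))).fun_sub
    (q.hasFDerivAt.comp_hasDerivAt t₀ he)
  have := hφ.nonneg_of_eventually_le (by
    filter_upwards [key] with t ht
    simp only [id, Function.comp]
    linarith)
  linarith

/-- The limit value is calibrated along a curve from every point. -/
theorem ConvexSuperlinear.exists_calibrated (hH : ConvexSuperlinear H)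
    (hM : BilipschitzCharts n M) {v : M → ℝ} {B : ℝ} (hvB : ∀ x y, |v x - v y| ≤ B * dist x y)
    (hv : TendstoUniformly (fun (lam : ℝ) x => discountedValue H lam x) v (𝓝[>] 0))
    (hdom : Dominated (lagrangian H) (criticalValue H) (fun x => -v x)) (x : M) :
    ∃ γ : ℝ → M, γ 0 = x ∧ (∀ T : ℝ, 0 ≤ T → AbsolutelyContinuousOnInterval γ 0 T) ∧
      ForwardCalibrated (lagrangian H) (criticalValue H) (fun x => -v x) γ := by
  have : ∀ lam : ℝ, 0 < lam → ∃ γ, Admissible H lam x γ ∧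
      discountedAction H lam γ ≤ discountedValue H lam x + lam := fun lam hlam =>
    (exists_discountedAction_lt hlam x hlam).imp fun γ h => ⟨h.1, h.2.le⟩
  have hne : Nonempty (ℝ → M) := ⟨fun _ => x⟩
  choose! Γ hΓ using this
  set U := Ultrafilter.of (𝓝[>] (0 : ℝ)) with hUdef
  have hU : (U : Filter ℝ) ≤ 𝓝[>] 0 := Ultrafilter.of_le _
  -- Along an ultrafilter the curves converge at all times simultaneously, by compactness of M; this
  -- replaces an Arzelà–Ascoli extraction.
  have : ∀ t, ∃ y, Tendsto (fun lam => Γ lam t) U (𝓝 y) := fun t => by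
    obtain ⟨y, -, hy⟩ := isCompact_univ.ultrafilter_le_nhds' (U.map fun lam => Γ lam t) univ_mem
    exact ⟨y, hy⟩
  choose γ hγ using this
  obtain ⟨B', hB'⟩ := hH.exists_lipschitz_limit hM hU hΓ hγ
  have hAC : ∀ a b, 0 ≤ a → a ≤ b → AbsolutelyContinuousOnInterval γ a b := by
    intro a b ha hab
    have hid : AbsolutelyContinuousOnInterval (fun t : ℝ => t) a b :=
      LipschitzWith.id.lipschitzOnWith.absolutelyContinuousOnInterval
    refine hid.of_dist_le_mul (C := B') fun s hs t ht => ?_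
    rw [uIcc_of_le hab] at hs ht
    rcases le_total s t with h | h
    · rw [dist_comm s t, Real.dist_eq, abs_of_nonneg (by linarith)]
      exact hB' s t (ha.trans hs.1) h
    · rw [dist_comm, Real.dist_eq, abs_of_nonneg (by linarith)]
      exact hB' t s (ha.trans ht.1) h
  refine ⟨γ, ?_, fun T hT => hAC 0 T le_rfl hT, fun s t hs hst => ?_⟩
  · refine tendsto_nhds_unique (hγ 0) (tendsto_const_nhds.congr' ?_)
    filter_upwards [hU self_mem_nhdsWithin] with lam hlam using (hΓ lam hlam).1.zero.symm
  have hac := hAC s t hs hst.le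
  have hg : AbsolutelyContinuousOnInterval (fun t => -v (γ t)) s t :=
    (ac_comp_of_lipschitz hac hvB).fun_neg
  have hvc : Continuous v := (LipschitzWith.of_dist_le_mul (K := B.toNNReal) fun x y => by
    rw [Real.dist_eq]
    exact (hvB x y).trans (by gcongr; exact B.le_coe_toNNReal)).continuous
  have hle : ∀ᵐ r, r ∈ Ioo s t → cost H γ r ≤ deriv (fun t => -v (γ t)) r := by
    filter_upwards [ae_mdifferentiableAt hM hac, hg.ae_differentiableAt] with r h1 h2 hr
    exact hH.cost_le_deriv hM hU hΓ hγ (fun u hu => hU (hv u hu)) hvc (hs.trans_lt hr.1) (h1 hr)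
      (h2 (by rw [uIcc_of_le hst.le]; exact Ioo_subset_Icc_self hr))
  have hi : IntervalIntegrable (fun r => lagrangian H (γ r) (velocity n γ r) + criticalValue H)
      volume s t := by
    refine IntervalIntegrable.add ?_ intervalIntegrable_const
    refine hH.intervalIntegrable_lagrangian hst.le
      (fun r hr => (hac.continuousAt hr).continuousWithinAt)
      (g := fun r => deriv (fun t => -v (γ t)) r - criticalValue H)
      (hg.intervalIntegrable_deriv.sub intervalIntegrable_const) ?_
    filter_upwards [hle] with r h1 hr
    have := h1 hr
    rw [cost] at this
    linarith
  -- Domination is one inequality; the other comes from integrating `hle`.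
  refine ⟨hi, le_antisymm (hdom s t γ hst.le hac hi) ?_⟩
  have h1 := hg.fun_neg.sub_le_integral hst.le hi.neg (by
    filter_upwards [hle, hg.ae_differentiableAt] with r h1 h2 hr
    have h3 := (h2 (by rw [uIcc_of_le hst.le]; exact Ioo_subset_Icc_self hr)).hasDerivAt
    rw [h3.fun_neg.deriv]
    exact neg_le_neg (h1 hr))
  simp only [Pi.neg_apply, intervalIntegral.integral_neg] at h1
  linarith

end Calibrated
end WeakKAM

/-! ### Assembly, and superlinearity for the Riemannian norm. -/

namespace WeakKAM

section Setting

variable {n : ℕ} {M : Type*} [MetricSpace M] [CompactSpace M] [ConnectedSpace M]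
    [ChartedSpace (EuclideanSpace ℝ (Fin n)) M] [IsManifold (𝓡 n) 1 M]
    {H : (x : M) → CotangentSpace n x → ℝ}

theorem ConvexSuperlinear.exists_limit (hH : ConvexSuperlinear H) (hM : BilipschitzCharts n M) :
    ∃ u₀ : M → ℝ,
      TendstoUniformly (fun (lam : ℝ) (x : M) => symmetricBackwardValue H lam x) u₀ (𝓝[>] 0) ∧
      TendstoUniformly (fun (lam : ℝ) (x : M) => forwardValue H lam x)
        (fun x => -u₀ x) (𝓝[>] 0) ∧
      IsForwardWeakKAM H (fun x => -u₀ x) := by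
  obtain ⟨v, B, hvB, hv, hdom⟩ := hH.exists_tendstoUniformly_value hM
  refine ⟨v, ?_, ?_, hdom, hH.exists_calibrated hM hvB hv hdom⟩
  · simpa only [symmetricBackwardValue_eq] using hv
  · simp only [forwardValue_eq]
    exact hv.fun_neg

end Setting

lemma bilipschitzCharts {n : ℕ} {M : Type*} [MetricSpace M]
    [ChartedSpace (EuclideanSpace ℝ (Fin n)) M] [IsManifold (𝓡 n) 1 M]
    [Bundle.RiemannianBundle (fun x : M => TangentSpace (𝓡 n) x)]
    [IsContinuousRiemannianBundle (EuclideanSpace ℝ (Fin n))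
      (fun x : M => TangentSpace (𝓡 n) x)]
    [IsRiemannianManifold (𝓡 n) M] : BilipschitzCharts n M := fun x =>
  exists_nhds_bilipschitz_extChartAt (𝓡 n) x

/-- The coordinate norm of a covector is at most ‖S‖ times its Riemannian norm, so growth of H at
rate |K| * ‖S‖ in the latter gives rate K in the former. -/
lemma exists_mul_norm_le_coordHamiltonian {n : ℕ} {M : Type*} [MetricSpace M]
    [ChartedSpace (EuclideanSpace ℝ (Fin n)) M] [IsManifold (𝓡 n) 1 M]
    [Bundle.RiemannianBundle (fun x : M => TangentSpace (𝓡 n) x)]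
    {H : (x : M) → CotangentSpace n x → ℝ} {x : M}
    (hsuper : Tendsto (fun p : CotangentSpace n x => H x p / ‖p‖)
      (comap (fun p : CotangentSpace n x => ‖p‖) atTop) atTop) (K : ℝ) :
    ∃ ρ : ℝ, ∀ q : EuclideanSpace ℝ (Fin n) →L[ℝ] ℝ, ρ ≤ ‖q‖ →
      K * ‖q‖ ≤ coordHamiltonian H x x q := by
  set S := (trivializationAt (EuclideanSpace ℝ (Fin n)) (TangentSpace (𝓡 n)) x).symmL ℝ x
  have hq : ∀ q : EuclideanSpace ℝ (Fin n) →L[ℝ] ℝ,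
      ‖q‖ ≤ ‖cotangentOfCoord x x q‖ * ‖S‖ := by
    intro q
    have h1 : q = ContinuousLinearMap.comp (cotangentOfCoord x x q) S := by
      ext w
      change q w = q (tangentCoord x x (S w))
      congr 1
      exact (Bundle.Trivialization.continuousLinearMapAt_symmL _
        (FiberBundle.mem_baseSet_trivializationAt' x) w).symm
    calc ‖q‖ = ‖ContinuousLinearMap.comp (cotangentOfCoord x x q) S‖ := congrArg norm h1
      _ ≤ _ := ContinuousLinearMap.opNorm_comp_le _ _
  have h1 := hsuper.eventually_ge_atTop (|K| * ‖S‖)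
  rw [eventually_comap] at h1
  obtain ⟨ρ, hρ⟩ := eventually_atTop.1 h1
  -- The 1 keeps q away from zero, so that ‖S‖ and the norm of the covector are positive and can be
  -- divided out.
  refine ⟨max (ρ * ‖S‖) 1, fun q hqρ => ?_⟩
  have h2 := hq q
  have h3 : 0 < ‖cotangentOfCoord x x q‖ * ‖S‖ :=
    (zero_lt_one.trans_le ((le_max_right _ _).trans hqρ)).trans_le h2
  have hS : 0 < ‖S‖ := pos_of_mul_pos_right h3 (norm_nonneg (cotangentOfCoord x x q))
  have hp : 0 < ‖cotangentOfCoord x x q‖ := pos_of_mul_pos_left h3 (norm_nonneg S)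
  have h4 := hρ _ (le_of_mul_le_mul_right (((le_max_left _ _).trans hqρ).trans h2) hS) _ rfl
  rw [le_div_iff₀ hp] at h4
  calc K * ‖q‖ ≤ |K| * ‖q‖ := by gcongr; exact le_abs_self K
    _ ≤ |K| * (‖cotangentOfCoord x x q‖ * ‖S‖) := by gcongr
    _ = |K| * ‖S‖ * ‖cotangentOfCoord x x q‖ := by ring
    _ ≤ _ := h4

end WeakKAM

theorem mainTheorem4 {n : ℕ} {M : Type*} [MetricSpace M] [CompactSpace M] [ConnectedSpace M]
    [ChartedSpace (EuclideanSpace ℝ (Fin n)) M] [IsManifold (𝓡 n) ∞ M]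
    [Bundle.RiemannianBundle (fun x : M => TangentSpace (𝓡 n) x)]
    [IsContMDiffRiemannianBundle (𝓡 n) ∞ (EuclideanSpace ℝ (Fin n))
      (fun x : M => TangentSpace (𝓡 n) x)]
    [IsRiemannianManifold (𝓡 n) M]
    (H : (x : M) → WeakKAM.CotangentSpace n x → ℝ)
    (hcont : Continuous fun q : WeakKAM.CotangentBundle n M => H q.proj q.snd)
    (hconv : ∀ x : M, ConvexOn ℝ univ (H x))
    (hsuper : ∀ x : M, Tendsto (fun p : WeakKAM.CotangentSpace n x => H x p / ‖p‖)
      (comap (fun p : WeakKAM.CotangentSpace n x => ‖p‖) atTop) atTop) :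
    ∃ u₀ : M → ℝ,
      TendstoUniformly (fun (lam : ℝ) (x : M) => WeakKAM.symmetricBackwardValue H lam x)
        u₀ (𝓝[>] 0) ∧
      TendstoUniformly (fun (lam : ℝ) (x : M) => WeakKAM.forwardValue H lam x)
        (fun x => -u₀ x) (𝓝[>] 0) ∧
      WeakKAM.IsForwardWeakKAM H (fun x => -u₀ x) := by
  have : IsManifold (𝓡 n) 1 M := IsManifold.of_le (n := ∞) (by norm_num)
  have : IsContinuousRiemannianBundle (EuclideanSpace ℝ (Fin n))
      (fun x : M => TangentSpace (𝓡 n) x) := by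
    obtain ⟨g, hg, hg'⟩ := IsContMDiffRiemannianBundle.exists_contMDiff (IB := 𝓡 n) (n := ∞)
      (F := EuclideanSpace ℝ (Fin n)) (E := fun x : M => TangentSpace (𝓡 n) x)
    exact ⟨g, hg.continuous, hg'⟩
  have hH : WeakKAM.ConvexSuperlinear H :=
    ⟨hcont, hconv, fun x => WeakKAM.exists_mul_norm_le_coordHamiltonian (hsuper x)⟩
  exact hH.exists_limit WeakKAM.bilipschitzCharts
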